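/- **Setting.** Let $\alpha\in(0,1)$, $\sigma=1-\alpha/2$, $\nu>0$, $L>0$, and let $\Omega\subset\mathbb R^d$ be a bounded open set (for instance a bounded Lipschitz domain). Let $f:\mathbb R\to\mathbb R$ be differentiable with $\sup_{y\in\mathbb R}|f'(y)|\le L$, and let $F$ be a primitive of $f$, $F'=f$. Let $V$ be the energy space of the boundary condition: $V=H^1_0(\Omega)$ (homogeneous Dirichlet), $V=H^1(\Omega)$ (homogeneous Neumann), or, if $\Omega$ is an open parallelepiped spanned by a basis of $\mathbb R^d$, $V=H^1_{\mathrm{per}}(\Omega)$, the $H^1(\Omega)$-closure of the smooth functions on $\mathbb R^d$ that are periodic with respect to this basis (periodic condition). *Kernel approximation.* Let $\varepsilon>0$, $0<\Delta t<T_{\rm soe}$, $N_q\ge1$, and let $\theta^\ell>0$, $\varpi^\ell>0$ $(1\le \ell\le N_q)$ satisfy $$\Big|s^{-\alpha}-\sum_{\ell=1}^{N_q}\varpi^\ell e^{-\theta^\ell s}\Big|\le\varepsilon\qquad\text{for all } s\in[\Delta t,T_{\rm soe}].$$ *Mesh and operator.* Let $0=t_0<t_1<t_2<\cdots$ be an infinite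 time mesh, $\tau_k=t_k-t_{k-1}$, $t_k^*=t_{k-1}+\sigma\tau_k$. For a sequence $u=(u^j)_{j\ge0}$ let $\Pi_{2,j}$ be the quadratic Lagrange interpolant of $u$ at $t_{j-1},t_j,t_{j+1}$ and $\Pi_{1,k}$ the linear one at $t_{k-1},t_k$. The fast L2-1$_\sigma$ operator is, for $k\ge1$, $$F_k^{\alpha,*}u=\frac1{\Gamma(1-\alpha)}\Big(\sum_{j=1}^{k-1}\int_{t_{j-1}}^{t_j}\Pi_{2,j}'(s)\sum_{\ell=1}^{N_q}\varpi^\ell e^{-\theta^\ell(t_k^*-s)}\,ds+\int_{t_{k-1}}^{t_k^*}\frac{\Pi_{1,k}'(s)}{(t_k^*-s)^\alpha}\,ds\Big).$$ *Scheme.* For the semilinear subdiffusion equation $\partial_t^\alpha u=\nu^2\Delta u-f(u)$ ($\partial_t^\alpha$ the Caputo derivative) with the given boundary condition, consider the Newton-linearized fast L2-1$_\sigma$ scheme $$F_k^{\alpha,*}u=\sigma\nu^2\Delta u^k+\tfrac\alpha2\nu^2\Delta u^{k-1}-f(u^{k-1})-\sigma f'(u^{k-1})(u^k-u^{k-1}),\qquad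 k\ge1,$$ in the weak sense: $u^n\in V$ for all $n\ge0$ and, for all $k\ge1$ and all $v\in V$, $$\int_\Omega (F_k^{\alpha,*}u)\,v\,dx=-\nu^2\int_\Omega\big(\sigma\nabla u^k+\tfrac\alpha2\nabla u^{k-1}\big)\cdot\nabla v\,dx-\int_\Omega\big(f(u^{k-1})+\sigma f'(u^{k-1})(u^k-u^{k-1})\big)v\,dx.$$ **Theorem.** Let $\eta\approx0.475329$ be the unique positive root of $1-3\rho^2(1+\rho)=0$. Assume that $$\frac{\tau_k}{\tau_{k-1}}\ge\eta\ (k\ge2),\qquad \varepsilon\le\frac1{5(1-\alpha)(\sigma\tau_k)^\alpha}\ (k\ge1),\qquad \Delta t\le\sigma\tau_k\ (k\ge2),\qquad T_{\rm soe}\ge\sigma\tau_{k+1}+\tau_k\ (k\ge2),$$ and that $$\tau_1^\alpha\le\frac{2-\alpha-(1-\alpha)\eta^{-\alpha}}{\sigma^\alpha[(3-\alpha)\Gamma(2-\alpha)L+(1-\alpha)\varepsilon]},\qquad \tau_k^\alpha\le\frac{1-(1-\alpha)\sigma^\alpha[(\sigma\eta)^{-\alpha}-(\sigma\eta+1)^{-\alpha}]}{\sigma^\alpha[(3-\alpha)\Gamma(2-\alpha)L+3(1-\alpha)\varepsilon]}\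 (k\ge2).$$ Then every solution $(u^n)_{n\ge0}$ of the scheme has integrable energy densities $\frac{\nu^2}2|\nabla u^n|^2+F(u^n)$, $n\ge0$, and satisfies, for all $n\ge1$, $$\int_\Omega\Big(\frac{\nu^2}2|\nabla u^n|^2+F(u^n)\Big)dx\le\int_\Omega\Big(\frac{\nu^2}2|\nabla u^0|^2+F(u^0)\Big)dx.$$ -/

import Mathlib

open MeasureTheory Filter Topology
open scoped ContDiff

namespace FastL21

noncomputable section

/-! # Time mesh, sum of exponentials and the fast L2-1σ operator -/

/-- A time mesh `0 = t 0 < t 1 < t 2 < …`. -/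
structure IsTimeMesh (t : ℕ → ℝ) : Prop where
  zero : t 0 = 0
  strictMono : StrictMono t

/-- The step `τ_k = t_k - t_{k-1}`; it is only used for `k ≥ 1`. -/
def step (t : ℕ → ℝ) (k : ℕ) : ℝ := t k - t (k - 1)

/-- The off-set point `t_k^* = t_{k-1} + σ τ_k` with `σ = 1 - α / 2`. -/
def tStar (α : ℝ) (t : ℕ → ℝ) (k : ℕ) : ℝ := t (k - 1) + (1 - α / 2) * step t k

/-- The quadratic Lagrange interpolant through `(t_i, y_i)`, `i = j-1, j, j+1` (for `j ≥ 1`). -/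
def quadInterp (t y : ℕ → ℝ) (j : ℕ) (s : ℝ) : ℝ :=
  (s - t j) * (s - t (j + 1)) / ((t (j - 1) - t j) * (t (j - 1) - t (j + 1))) * y (j - 1)
    + (s - t (j - 1)) * (s - t (j + 1)) / ((t j - t (j - 1)) * (t j - t (j + 1))) * y j
    + (s - t (j - 1)) * (s - t j) / ((t (j + 1) - t (j - 1)) * (t (j + 1) - t j)) * y (j + 1)

/-- The linear Lagrange interpolant through `(t_i, y_i)`, `i = k-1, k` (for `k ≥ 1`). -/
def linInterp (t y : ℕ → ℝ) (k : ℕ) (s : ℝ) : ℝ :=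
  (s - t k) / (t (k - 1) - t k) * y (k - 1) + (s - t (k - 1)) / (t k - t (k - 1)) * y k

/-- The sum of exponentials `s ↦ ∑_ℓ ϖ^ℓ exp (-θ^ℓ s)`. -/
def soe {Nq : ℕ} (θ ϖ : Fin Nq → ℝ) (s : ℝ) : ℝ := ∑ l, ϖ l * Real.exp (-(θ l) * s)

/-- Positive nodes `θ` and positive weights `ϖ` whose sum of exponentials approximates the kernel
`s ^ (-α)` with absolute error at most `ε` on `[Δt, Tsoe]`. -/
structure IsSOE (α ε Δt Tsoe : ℝ) {Nq : ℕ} (θ ϖ : Fin Nq → ℝ) : Prop where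
  card_pos : 0 < Nq
  node_pos : ∀ l, 0 < θ l
  weight_pos : ∀ l, 0 < ϖ l
  approx : ∀ s ∈ Set.Icc Δt Tsoe, |s ^ (-α) - soe θ ϖ s| ≤ ε

/-- The fast L2-1σ operator `F_k^{α,*}` (for `k ≥ 1`) applied to a scalar sequence `y`. -/
def fastOp (α : ℝ) (t : ℕ → ℝ) {Nq : ℕ} (θ ϖ : Fin Nq → ℝ) (k : ℕ) (y : ℕ → ℝ) : ℝ :=
  1 / Real.Gamma (1 - α) *
    (∑ j ∈ Finset.Ico 1 k,
        (∫ s in t (j - 1)..t j, deriv (quadInterp t y j) s * soe θ ϖ (tStar α t k - s))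
      + ∫ s in t (k - 1)..tStar α t k, deriv (linInterp t y k) s / (tStar α t k - s) ^ α)

/-! # Sobolev spaces and boundary conditions -/

/-- `u ∈ H¹(Ω)` with weak gradient `g`: both are square integrable on `Ω`, and integration by parts
holds against every smooth function with compact support in `Ω`. -/
structure MemH1 {d : ℕ} (Ω : Set (EuclideanSpace ℝ (Fin d))) (u : EuclideanSpace ℝ (Fin d) → ℝ)
    (g : EuclideanSpace ℝ (Fin d) → EuclideanSpace ℝ (Fin d)) : Prop where
  memLp : MemLp u 2 (volume.restrict Ω)
  memLp_grad : MemLp g 2 (volume.restrict Ω)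
  integral_by_parts : ∀ φ : EuclideanSpace ℝ (Fin d) → ℝ,
    ContDiff ℝ ∞ φ → HasCompactSupport φ → tsupport φ ⊆ Ω →
      ∫ x in Ω, u x • gradient φ x = -∫ x in Ω, φ x • g x

/-- The pair `(u, g)` is an `L²(Ω)` limit of pairs `(φ, ∇φ)` with `φ` in the class `C`. -/
def IsH1Limit {d : ℕ} (Ω : Set (EuclideanSpace ℝ (Fin d)))
    (C : (EuclideanSpace ℝ (Fin d) → ℝ) → Prop) (u : EuclideanSpace ℝ (Fin d) → ℝ)
    (g : EuclideanSpace ℝ (Fin d) → EuclideanSpace ℝ (Fin d)) : Prop :=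
  ∃ φ : ℕ → EuclideanSpace ℝ (Fin d) → ℝ, (∀ m, C (φ m)) ∧
    Tendsto (fun m => eLpNorm (fun x => u x - φ m x) 2 (volume.restrict Ω)) atTop (𝓝 0) ∧
    Tendsto (fun m => eLpNorm (fun x => g x - gradient (φ m) x) 2 (volume.restrict Ω))
      atTop (𝓝 0)

/-- The boundary conditions: homogeneous Dirichlet, homogeneous Neumann, or periodic with respect
to the translations by the vectors of a basis `b` of `ℝᵈ`; `c` is the corner of the periodic
cell. -/
inductive BoundaryCondition (d : ℕ)
  | dirichlet : BoundaryCondition d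
  | neumann : BoundaryCondition d
  | periodic (c : EuclideanSpace ℝ (Fin d))
      (b : Module.Basis (Fin d) ℝ (EuclideanSpace ℝ (Fin d))) : BoundaryCondition d

/-- Periodic boundary conditions are imposed on the open cell `{c + ∑ rᵢ bᵢ : 0 < rᵢ < 1}`;
the other ones make sense on every `Ω`. -/
def BoundaryCondition.Compatible {d : ℕ} (bc : BoundaryCondition d)
    (Ω : Set (EuclideanSpace ℝ (Fin d))) : Prop :=
  match bc with
  | .dirichlet => True
  | .neumann => True
  | .periodic c b =>
      Ω = {x | ∃ r : Fin d → ℝ, (∀ i, r i ∈ Set.Ioo (0 : ℝ) 1) ∧ x = c + ∑ i, r i • b i}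

/-- `u`, with weak gradient `g`, belongs to the energy space of the boundary condition: `H¹₀(Ω)`
(closure of the smooth functions with compact support in `Ω`) for Dirichlet, `H¹(Ω)` for Neumann,
and `H¹_per(Ω)` (closure of the smooth periodic functions) for periodic conditions. -/
def BoundaryCondition.MemSpace {d : ℕ} (bc : BoundaryCondition d)
    (Ω : Set (EuclideanSpace ℝ (Fin d))) (u : EuclideanSpace ℝ (Fin d) → ℝ)
    (g : EuclideanSpace ℝ (Fin d) → EuclideanSpace ℝ (Fin d)) : Prop :=
  match bc with
  | .dirichlet => MemH1 Ω u g ∧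
      IsH1Limit Ω (fun φ => ContDiff ℝ ∞ φ ∧ HasCompactSupport φ ∧ tsupport φ ⊆ Ω) u g
  | .neumann => MemH1 Ω u g
  | .periodic _ b => MemH1 Ω u g ∧
      IsH1Limit Ω (fun φ => ContDiff ℝ ∞ φ ∧ ∀ i x, φ (x + b i) = φ x) u g

/-! # The scheme and the energy -/

/-- `u n`, with weak gradients `G n`, is a solution of the Newton-linearized fast L2-1σ scheme
`F_k^{α,*} u = σ ν² Δu^k + (α/2) ν² Δu^{k-1} - f(u^{k-1}) - σ f'(u^{k-1}) (u^k - u^{k-1})`, `k ≥ 1`,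
`σ = 1 - α/2`, in the weak sense: all iterates lie in the energy space of the boundary
condition, and the equation, tested with any member of this space, holds after integrating the
Laplacians by parts. -/
structure IsNumericalSolution {d : ℕ} (bc : BoundaryCondition d)
    (Ω : Set (EuclideanSpace ℝ (Fin d))) (α ν : ℝ) (f : ℝ → ℝ) (t : ℕ → ℝ)
    {Nq : ℕ} (θ ϖ : Fin Nq → ℝ) (u : ℕ → EuclideanSpace ℝ (Fin d) → ℝ)
    (G : ℕ → EuclideanSpace ℝ (Fin d) → EuclideanSpace ℝ (Fin d)) : Prop where
  mem : ∀ n, bc.MemSpace Ω (u n) (G n)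
  scheme : ∀ k, 1 ≤ k → ∀ v w, bc.MemSpace Ω v w →
    ∫ x in Ω, fastOp α t θ ϖ k (fun j => u j x) * v x =
      -(ν ^ 2 * ∫ x in Ω, inner ℝ ((1 - α / 2) • G k x + (α / 2) • G (k - 1) x) (w x))
        - ∫ x in Ω, (f (u (k - 1) x)
            + (1 - α / 2) * deriv f (u (k - 1) x) * (u k x - u (k - 1) x)) * v x

/-- The energy density `(ν²/2) |∇u|² + F(u)` of `u` with gradient `g`. -/
def energyDensity {d : ℕ} (ν : ℝ) (F : ℝ → ℝ) (u : EuclideanSpace ℝ (Fin d) → ℝ)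
    (g : EuclideanSpace ℝ (Fin d) → EuclideanSpace ℝ (Fin d))
    (x : EuclideanSpace ℝ (Fin d)) : ℝ :=
  ν ^ 2 / 2 * ‖g x‖ ^ 2 + F (u x)

/-- The conditions on mesh and kernel approximation under which the bilinear form of the fast
L2-1σ operator is positive semidefinite. -/
structure MeshCondition (α η ε Δt Tsoe : ℝ) (t : ℕ → ℝ) : Prop where
  ratio : ∀ k, 2 ≤ k → η ≤ step t k / step t (k - 1)
  tolerance : ∀ k, 1 ≤ k → ε ≤ 1 / (5 * (1 - α) * ((1 - α / 2) * step t k) ^ α)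
  cutoff : ∀ k, 2 ≤ k → Δt ≤ (1 - α / 2) * step t k
  horizon : ∀ k, 2 ≤ k → (1 - α / 2) * step t (k + 1) + step t k ≤ Tsoe

/-- The additional upper bounds on the time steps. -/
structure StepBound (α η ε L : ℝ) (t : ℕ → ℝ) : Prop where
  first : step t 1 ^ α ≤
    (2 - α - (1 - α) * η ^ (-α)) /
      ((1 - α / 2) ^ α * ((3 - α) * Real.Gamma (2 - α) * L + (1 - α) * ε))
  later : ∀ k, 2 ≤ k → step t k ^ α ≤
    (1 - (1 - α) * (1 - α / 2) ^ α *
        (((1 - α / 2) * η) ^ (-α) - ((1 - α / 2) * η + 1) ^ (-α))) /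
      ((1 - α / 2) ^ α * ((3 - α) * Real.Gamma (2 - α) * L + 3 * (1 - α) * ε))

end

end FastL21

namespace FastL21

/-! # Semiseparable quadratic forms -/

/-! Testing the scheme at step `k` with `u^k - u^{k-1}` reduces stability to a lower bound on a
quadratic form in time. The gradient term yields the increment of `(ν²/2)|∇u|²` plus a nonnegative
square. Replacing `F(u^k) - F(u^{k-1})` by the Newton-linearized reaction costs at most `(3 - α) L /
2` times the squared increment. After summation over `k`, it suffices that, pointwise in space, `∑
F_k y · δ_k ≥ (3 - α) L / 2 · ∑ δ_k²` for the increments `δ_k` of any real sequence `y`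
(`sum_sq_le_sum_fastOp_mul`).

For a single exponential, the coefficient of a past increment `δ_j` in the history part is a product
`x_k Y_j`. Here `x_k = exp (-θ t_k^*)` decreases, and `Y = histWeight` increases by the ratio
condition. Such a semiseparable form is positive semidefinite, even with a diagonal smaller than the
natural one (`semiseparable_nonneg`).

The proof then compares diagonals (`sum_diagonal_le`). Summed over the exponentials, the reduced
diagonal involves the sum of exponentials at no more than three points. Each value differs from the
power kernel by at most `ε`. The singular local term of the operator dominates the result, together
with the Lipschitz cost, precisely under the bounds on the time steps. -/

theorem sum_increment_mul_partialSum (Y δ : ℕ → ℝ) (hY : Y 0 = 0) (n : ℕ) :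
    ∑ i ∈ Finset.range n, (Y (i + 1) - Y i) *
        (∑ j ∈ Finset.range n, δ j - ∑ j ∈ Finset.range i, δ j) =
      ∑ j ∈ Finset.range n, Y (j + 1) * δ j := by
  induction n with
  | zero => simp
  | succ n ih =>
    rw [Finset.sum_range_succ, Finset.sum_range_succ δ n,
      Finset.sum_range_succ (fun j => Y (j + 1) * δ j) n, ← ih]
    have h : ∑ i ∈ Finset.range n, (Y (i + 1) - Y i) *
        (∑ j ∈ Finset.range n, δ j + δ n - ∑ j ∈ Finset.range i, δ j) =
        ∑ i ∈ Finset.range n, (Y (i + 1) - Y i) *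
        (∑ j ∈ Finset.range n, δ j - ∑ j ∈ Finset.range i, δ j) + Y n * δ n := by
      have h2 : Y n * δ n = ∑ i ∈ Finset.range n, (Y (i + 1) - Y i) * δ n := by
        rw [← Finset.sum_mul, Finset.sum_range_sub, hY, sub_zero]
      rw [h2, ← Finset.sum_add_distrib]
      exact Finset.sum_congr rfl fun i _ => by ring
    rw [h]
    ring

/-- The quadratic form of the semiseparable matrix `(Y (min i j + 1))`, as a sum of squares. -/
def squareSum (Y δ : ℕ → ℝ) (n : ℕ) : ℝ :=
  ∑ i ∈ Finset.range n, (Y (i + 1) - Y i) *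
    (∑ j ∈ Finset.range n, δ j - ∑ j ∈ Finset.range i, δ j) ^ 2

theorem squareSum_succ (Y δ : ℕ → ℝ) (hY : Y 0 = 0) (n : ℕ) :
    squareSum Y δ (n + 1) = squareSum Y δ n
      + 2 * δ n * ∑ j ∈ Finset.range n, Y (j + 1) * δ j + Y (n + 1) * δ n ^ 2 := by
  have h2 : Y n * δ n ^ 2 = ∑ i ∈ Finset.range n, (Y (i + 1) - Y i) * δ n ^ 2 := by
    rw [← Finset.sum_mul, Finset.sum_range_sub, hY, sub_zero]
  have h : ∑ i ∈ Finset.range n, (Y (i + 1) - Y i) *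
        (∑ j ∈ Finset.range n, δ j + δ n - ∑ j ∈ Finset.range i, δ j) ^ 2 =
      squareSum Y δ n + 2 * δ n * ∑ j ∈ Finset.range n, Y (j + 1) * δ j + Y n * δ n ^ 2 := by
    rw [h2, ← sum_increment_mul_partialSum Y δ hY n, squareSum, Finset.mul_sum,
      ← Finset.sum_add_distrib, ← Finset.sum_add_distrib]
    exact Finset.sum_congr rfl fun i _ => by ring
  rw [squareSum, Finset.sum_range_succ, Finset.sum_range_succ _ n, h]
  ring

theorem increment_mul_sq_le_squareSum (Y δ : ℕ → ℝ) (hY : Monotone Y) (n : ℕ) :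
    (Y (n + 1) - Y n) * δ n ^ 2 ≤ squareSum Y δ (n + 1) := by
  rw [squareSum, Finset.sum_range_succ, Finset.sum_range_succ _ n]
  have h : 0 ≤ ∑ i ∈ Finset.range n, (Y (i + 1) - Y i) *
        (∑ j ∈ Finset.range n, δ j + δ n - ∑ j ∈ Finset.range i, δ j) ^ 2 :=
    Finset.sum_nonneg fun i _ =>
      mul_nonneg (sub_nonneg.2 (hY (Nat.le_succ i))) (sq_nonneg _)
  have h2 : (∑ j ∈ Finset.range n, δ j + δ n - ∑ j ∈ Finset.range n, δ j) = δ n := by ring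
  rw [h2]
  linarith

theorem squareSum_nonneg (Y δ : ℕ → ℝ) (hY : Monotone Y) (n : ℕ) : 0 ≤ squareSum Y δ n :=
  Finset.sum_nonneg fun i _ => mul_nonneg (sub_nonneg.2 (hY (Nat.le_succ i))) (sq_nonneg _)

/-- With `S = squareSum` and the natural diagonal `x m * Y (m + 1)`, the sum is `∑ x m (S (m + 1) -
S m)`. Summation by parts turns it into `x n * S n + ∑ (x m - x (m + 1)) S (m + 1)`. The last square
in `S (m + 1)` is `(Y (m + 1) - Y m) δ m ^ 2`, which pays for lowering the diagonal by `(x m - x (m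
+ 1)) (Y (m + 1) - Y m)`. -/
theorem semiseparable_nonneg (x Y δ : ℕ → ℝ) (hx : Antitone x) (hx0 : ∀ k, 0 ≤ x k)
    (hY : Monotone Y) (hY0 : Y 0 = 0) (n : ℕ) :
    0 ≤ ∑ m ∈ Finset.range n,
      (2 * x m * δ m * ∑ j ∈ Finset.range m, Y (j + 1) * δ j
        + (x (m + 1) * Y (m + 1) + (x m - x (m + 1)) * Y m) * δ m ^ 2) := by
  suffices h : x n * squareSum Y δ n ≤ ∑ m ∈ Finset.range n,
      (2 * x m * δ m * ∑ j ∈ Finset.range m, Y (j + 1) * δ j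
        + (x (m + 1) * Y (m + 1) + (x m - x (m + 1)) * Y m) * δ m ^ 2) from
    (mul_nonneg (hx0 n) (squareSum_nonneg Y δ hY n)).trans h
  induction n with
  | zero => simp [squareSum]
  | succ n ih =>
    rw [Finset.sum_range_succ]
    have h1 := mul_le_mul_of_nonneg_left (increment_mul_sq_le_squareSum Y δ hY n)
      (sub_nonneg.2 (hx (Nat.le_succ n)))
    have h2 := squareSum_succ Y δ hY0 n
    rw [Nat.succ_eq_add_one] at h1
    have h3 : x n * squareSum Y δ (n + 1) = x n * (squareSum Y δ n
      + 2 * δ n * ∑ j ∈ Finset.range n, Y (j + 1) * δ j + Y (n + 1) * δ n ^ 2) := by rw [← h2]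
    linarith

/-! # Moments of exponentials -/

section Moments

variable {θ p q r : ℝ}

/-- The first moment of `exp (θ s)` about the midpoint of `[p, q]`, times two. -/
noncomputable def expMoment (θ p q : ℝ) : ℝ :=
  ∫ s in p..q, (2 * s - p - q) * Real.exp (θ * s)

/-- The mean of `exp (θ s)` over `[p, q]`. -/
noncomputable def expMean (θ p q : ℝ) : ℝ := (∫ s in p..q, Real.exp (θ * s)) / (q - p)

theorem hasDerivAt_exp_mul (θ s : ℝ) :
    HasDerivAt (fun s => Real.exp (θ * s)) (θ * Real.exp (θ * s)) s := by
  have := ((hasDerivAt_id s).const_mul θ).exp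
  simpa [mul_comm] using this

/-- Integration by parts: `2 s - p - q` is minus the derivative of `(s - p) (q - s)`, which vanishes
at both endpoints. The new integrand has a sign, giving both the positivity and the cubic bound
below. -/
theorem expMoment_eq (θ p q : ℝ) :
    expMoment θ p q = θ * ∫ s in p..q, (s - p) * (q - s) * Real.exp (θ * s) := by
  have h : ∀ s ∈ Set.uIcc p q, HasDerivAt (fun s => (s - p) * (q - s) * Real.exp (θ * s))
      (θ * ((s - p) * (q - s) * Real.exp (θ * s)) - (2 * s - p - q) * Real.exp (θ * s)) s := by
    intro s _
    have := ((((hasDerivAt_id s).sub_const p).mul ((hasDerivAt_id s).const_sub q)).mul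
      (hasDerivAt_exp_mul θ s))
    refine this.congr_deriv ?_
    simp only [id, Pi.mul_apply]
    ring
  have h2 := intervalIntegral.integral_eq_sub_of_hasDerivAt h
    (Continuous.intervalIntegrable (by fun_prop) _ _)
  rw [intervalIntegral.integral_sub (Continuous.intervalIntegrable (by fun_prop) _ _)
    (Continuous.intervalIntegrable (by fun_prop) _ _),
    intervalIntegral.integral_const_mul] at h2
  simp at h2
  rw [expMoment]
  linarith

theorem expMoment_nonneg (hθ : 0 < θ) (hpq : p ≤ q) : 0 ≤ expMoment θ p q := by
  rw [expMoment_eq]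
  refine mul_nonneg hθ.le (intervalIntegral.integral_nonneg hpq fun s hs => ?_)
  exact mul_nonneg (mul_nonneg (sub_nonneg.2 hs.1) (sub_nonneg.2 hs.2)) (Real.exp_pos _).le

theorem expMoment_le (hθ : 0 < θ) (hpq : p ≤ q) :
    expMoment θ p q ≤ θ * (Real.exp (θ * q) * ((q - p) ^ 3 / 6)) := by
  rw [expMoment_eq]
  refine mul_le_mul_of_nonneg_left ?_ hθ.le
  have h1 : ∫ s in p..q, (s - p) * (q - s) * Real.exp (θ * q) =
      Real.exp (θ * q) * ((q - p) ^ 3 / 6) := by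
    have h : ∀ s ∈ Set.uIcc p q, HasDerivAt
        (fun s => ((s - p) ^ 2 * (q - p) / 2 - (s - p) ^ 3 / 3) * Real.exp (θ * q))
        ((s - p) * (q - s) * Real.exp (θ * q)) s := by
      intro s _
      have h0 := (hasDerivAt_id s).sub_const p
      have := (((((h0.pow 2).mul_const (q - p)).div_const 2).sub ((h0.pow 3).div_const 3)).mul_const
        (Real.exp (θ * q)))
      refine this.congr_deriv ?_
      simp only [id, Nat.cast_ofNat]
      ring
    rw [intervalIntegral.integral_eq_sub_of_hasDerivAt h
      (Continuous.intervalIntegrable (by fun_prop) _ _)]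
    ring
  rw [← h1]
  refine intervalIntegral.integral_mono_on hpq (Continuous.intervalIntegrable (by fun_prop) _ _)
    (Continuous.intervalIntegrable (by fun_prop) _ _) fun s hs => ?_
  refine mul_le_mul_of_nonneg_left (Real.exp_le_exp.2 ?_)
    (mul_nonneg (sub_nonneg.2 hs.1) (sub_nonneg.2 hs.2))
  exact mul_le_mul_of_nonneg_left hs.2 hθ.le

/-- Integrating the derivative of `(s - p) exp (θ s)` expresses the gap between the endpoint value
and the mean as an integral of `θ (s - p) exp (θ s)`, bounded below by freezing the exponential at
`p`. This gap is the room that absorbs `expRight` of the preceding interval. -/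
theorem expMean_add_le (hθ : 0 < θ) (hpq : p < q) :
    expMean θ p q + θ * Real.exp (θ * p) * (q - p) / 2 ≤ Real.exp (θ * q) := by
  have h : ∀ s ∈ Set.uIcc p q, HasDerivAt (fun s => (s - p) * Real.exp (θ * s))
      (Real.exp (θ * s) + θ * ((s - p) * Real.exp (θ * s))) s := by
    intro s _
    have := ((hasDerivAt_id s).sub_const p).mul (hasDerivAt_exp_mul θ s)
    refine this.congr_deriv ?_
    simp only [id]
    ring
  have h2 := intervalIntegral.integral_eq_sub_of_hasDerivAt h
    (Continuous.intervalIntegrable (by fun_prop) _ _)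
  rw [intervalIntegral.integral_add (Continuous.intervalIntegrable (by fun_prop) _ _)
    (Continuous.intervalIntegrable (by fun_prop) _ _),
    intervalIntegral.integral_const_mul] at h2
  have h1 : ∫ s in p..q, (s - p) * Real.exp (θ * p) =
      Real.exp (θ * p) * ((q - p) ^ 2 / 2) := by
    have h : ∀ s ∈ Set.uIcc p q, HasDerivAt
        (fun s => ((s - p) ^ 2 / 2) * Real.exp (θ * p))
        ((s - p) * Real.exp (θ * p)) s := by
      intro s _
      have h0 := (hasDerivAt_id s).sub_const p
      have := ((h0.pow 2).div_const 2).mul_const (Real.exp (θ * p))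
      refine this.congr_deriv ?_
      simp only [id, Nat.cast_ofNat]
      ring
    rw [intervalIntegral.integral_eq_sub_of_hasDerivAt h
      (Continuous.intervalIntegrable (by fun_prop) _ _)]
    ring
  have h3 : ∫ s in p..q, (s - p) * Real.exp (θ * p) ≤ ∫ s in p..q, (s - p) * Real.exp (θ * s) := by
    refine intervalIntegral.integral_mono_on hpq.le
      (Continuous.intervalIntegrable (by fun_prop) _ _)
      (Continuous.intervalIntegrable (by fun_prop) _ _) fun s hs => ?_
    exact mul_le_mul_of_nonneg_left
      (Real.exp_le_exp.2 (mul_le_mul_of_nonneg_left hs.1 hθ.le)) (sub_nonneg.2 hs.1)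
  have h4 := mul_le_mul_of_nonneg_left h3 hθ.le
  have hpos : 0 < q - p := sub_pos.2 hpq
  rw [expMean, div_add' _ _ _ hpos.ne', div_le_iff₀ hpos]
  rw [h1] at h4
  simp at h2
  linarith

/-- The integral of `exp (θ s)` over `[p, q]` against the derivative of the quadratic interpolant
through `p < q < r` with increments `1` on `[p, q]` and `0` on `[q, r]`. -/
noncomputable def expLeft (θ p q r : ℝ) : ℝ :=
  expMean θ p q - expMoment θ p q / ((q - p) * (r - p))

/-- The integral of `exp (θ s)` over `[p, q]` against the derivative of the quadratic interpolant
through `p < q < r` with increments `0` on `[p, q]` and `1` on `[q, r]`. -/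
noncomputable def expRight (θ p q r : ℝ) : ℝ := expMoment θ p q / ((r - q) * (r - p))

theorem expRight_nonneg (hθ : 0 < θ) (hpq : p < q) (hqr : q < r) : 0 ≤ expRight θ p q r :=
  div_nonneg (expMoment_nonneg hθ hpq.le)
    (mul_nonneg (sub_nonneg.2 hqr.le) (sub_nonneg.2 (hpq.trans hqr).le))

theorem expLeft_le_expMean (hθ : 0 < θ) (hpq : p < q) (hqr : q < r) :
    expLeft θ p q r ≤ expMean θ p q :=
  sub_le_self _ (div_nonneg (expMoment_nonneg hθ hpq.le)
    (mul_nonneg (sub_nonneg.2 hpq.le) (sub_nonneg.2 (hpq.trans hqr).le)))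

theorem expLeft_le (hθ : 0 < θ) (hpq : p < q) (hqr : q < r) :
    expLeft θ p q r ≤ Real.exp (θ * q) := by
  have h1 := expMean_add_le hθ hpq
  have h2 : 0 ≤ θ * Real.exp (θ * p) * (q - p) / 2 := by
    have := sub_pos.2 hpq
    positivity
  linarith [expLeft_le_expMean hθ hpq hqr]

/-- The cubic hypothesis, in terms of `ρ = (r - q) / (q - p)`, reads `1 ≤ 3 ρ² (1 + ρ)`; this is the
origin of the threshold `η`. The constant 3 is the 6 of `expMoment_le` divided by the 2 in the
target, which is chosen to match the gap in `expMean_add_le`. -/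
theorem expRight_le (hθ : 0 < θ) (hpq : p < q) (hqr : q < r)
    (h : (q - p) ^ 3 ≤ 3 * (r - q) ^ 2 * (r - p)) :
    expRight θ p q r ≤ θ * Real.exp (θ * q) * (r - q) / 2 := by
  have h1 := expMoment_le hθ hpq.le
  have hr : 0 < r - q := sub_pos.2 hqr
  have hp : 0 < r - p := sub_pos.2 (hpq.trans hqr)
  rw [expRight, div_le_iff₀ (mul_pos hr hp)]
  have h2 : 0 ≤ θ * Real.exp (θ * q) := by positivity
  nlinarith [mul_le_mul_of_nonneg_left h h2]

theorem expLeft_add_expRight_le {o : ℝ} (hθ : 0 < θ) (hop : o < p) (hpq : p < q) (hqr : q < r)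
    (h : (p - o) ^ 3 ≤ 3 * (q - p) ^ 2 * (q - o)) :
    expLeft θ p q r + expRight θ o p q ≤ Real.exp (θ * q) := by
  linarith [expRight_le hθ hop hpq h, expMean_add_le hθ hpq, expLeft_le_expMean hθ hpq hqr]

theorem expLeft_eq_integral (hpq : p < q) (hqr : q < r) :
    expLeft θ p q r =
      ∫ s in p..q, (r + q - 2 * s) / ((q - p) * (r - p)) * Real.exp (θ * s) := by
  have hq : q - p ≠ 0 := (sub_pos.2 hpq).ne'
  have hp : r - p ≠ 0 := (sub_pos.2 (hpq.trans hqr)).ne'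
  rw [expLeft, expMean, expMoment, ← intervalIntegral.integral_div,
    ← intervalIntegral.integral_div,
    ← intervalIntegral.integral_sub (Continuous.intervalIntegrable (by fun_prop) _ _)
      (Continuous.intervalIntegrable (by fun_prop) _ _)]
  refine intervalIntegral.integral_congr fun s _ => ?_
  field_simp
  ring

theorem expRight_eq_integral :
    expRight θ p q r =
      ∫ s in p..q, (2 * s - p - q) / ((r - q) * (r - p)) * Real.exp (θ * s) := by
  rw [expRight, expMoment, ← intervalIntegral.integral_div]
  refine intervalIntegral.integral_congr fun s _ => ?_
  ring

/-- By `expLeft_eq_integral`, `expLeft` averages the increasing function `exp (θ s)` over `[p, q]`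
against a nonnegative weight of total mass one. -/
theorem exp_le_expLeft (hθ : 0 < θ) (hpq : p < q) (hqr : q < r) :
    Real.exp (θ * p) ≤ expLeft θ p q r := by
  have hq : 0 < q - p := (sub_pos.2 hpq)
  have hp : 0 < r - p := (sub_pos.2 (hpq.trans hqr))
  have h1 : ∫ s in p..q, (r + q - 2 * s) / ((q - p) * (r - p)) * Real.exp (θ * p) =
      Real.exp (θ * p) := by
    have h : ∀ s ∈ Set.uIcc p q, HasDerivAt
        (fun s => ((r + q) * s - s ^ 2) / ((q - p) * (r - p)) * Real.exp (θ * p))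
        ((r + q - 2 * s) / ((q - p) * (r - p)) * Real.exp (θ * p)) s := by
      intro s _
      have h0 := hasDerivAt_id s
      have := (((h0.const_mul (r + q)).sub (h0.pow 2)).div_const ((q - p) * (r - p))).mul_const
        (Real.exp (θ * p))
      refine this.congr_deriv ?_
      simp only [id, Nat.cast_ofNat]
      ring
    rw [intervalIntegral.integral_eq_sub_of_hasDerivAt h
      (Continuous.intervalIntegrable (by fun_prop) _ _)]
    field_simp
    ring
  rw [expLeft_eq_integral hpq hqr]
  refine h1.symm.trans_le ?_
  refine intervalIntegral.integral_mono_on hpq.le (Continuous.intervalIntegrable (by fun_prop) _ _)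
    (Continuous.intervalIntegrable (by fun_prop) _ _) fun s hs => ?_
  refine mul_le_mul_of_nonneg_left
    (Real.exp_le_exp.2 (mul_le_mul_of_nonneg_left hs.1 hθ.le)) (div_nonneg ?_ (by positivity))
  linarith [hs.2]

end Moments

/-! # Coefficients of the fast L2-1σ operator -/

/-- The weight of the increment over the current interval in the history part of the operator
for the kernel `exp (-θ s)`, up to the factor `exp (-θ t_k^*)`. -/
noncomputable def localWeight (θ : ℝ) (t : ℕ → ℝ) : ℕ → ℝ
  | 0 => 0
  | j + 1 => expRight θ (t j) (t (j + 1)) (t (j + 2))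

/-- The weight of an increment over a past interval in the history part of the operator
for the kernel `exp (-θ s)`, up to the factor `exp (-θ t_k^*)`. -/
noncomputable def histWeight (θ : ℝ) (t : ℕ → ℝ) : ℕ → ℝ
  | 0 => 0
  | j + 1 => expLeft θ (t j) (t (j + 1)) (t (j + 2)) + localWeight θ t j

theorem deriv_quadInterp {t : ℕ → ℝ} (ht : StrictMono t) (y : ℕ → ℝ) (j : ℕ) (s : ℝ) :
    deriv (quadInterp t y (j + 1)) s =
      (y (j + 1) - y j) *
          ((t (j + 2) + t (j + 1) - 2 * s) / ((t (j + 1) - t j) * (t (j + 2) - t j)))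
        + (y (j + 2) - y (j + 1)) *
          ((2 * s - t j - t (j + 1)) / ((t (j + 2) - t (j + 1)) * (t (j + 2) - t j))) := by
  have h1 : t (j + 1) - t j ≠ 0 := (sub_pos.2 (ht (by omega))).ne'
  have h2 : t (j + 2) - t (j + 1) ≠ 0 := (sub_pos.2 (ht (by omega))).ne'
  have h3 : t (j + 2) - t j ≠ 0 := (sub_pos.2 (ht (by omega))).ne'
  have h1' : t j - t (j + 1) ≠ 0 := by rwa [← neg_ne_zero, neg_sub]
  have h2' : t (j + 1) - t (j + 2) ≠ 0 := by rwa [← neg_ne_zero, neg_sub]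
  have h3' : t j - t (j + 2) ≠ 0 := by rwa [← neg_ne_zero, neg_sub]
  -- Newton's divided-difference form, in which only increments of `y` appear.
  have hq : quadInterp t y (j + 1) = fun s => y j
      + (y (j + 1) - y j) / (t (j + 1) - t j) * (s - t j)
      + ((y (j + 2) - y (j + 1)) / (t (j + 2) - t (j + 1)) - (y (j + 1) - y j) / (t (j + 1) - t j))
        / (t (j + 2) - t j) * ((s - t j) * (s - t (j + 1))) := by
    funext s
    simp only [quadInterp, Nat.add_sub_cancel, add_assoc, Nat.reduceAdd]
    field_simp
    ring
  have h0 := hasDerivAt_id s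
  rw [hq]
  refine (((((h0.sub_const (t j)).const_mul ((y (j + 1) - y j) / (t (j + 1) - t j))).const_add
    (y j)).add (((h0.sub_const (t j)).mul (h0.sub_const (t (j + 1)))).const_mul
      (((y (j + 2) - y (j + 1)) / (t (j + 2) - t (j + 1)) - (y (j + 1) - y j) / (t (j + 1) - t j))
        / (t (j + 2) - t j)))).deriv).trans ?_
  simp only [id]
  field_simp
  ring

theorem deriv_linInterp {t : ℕ → ℝ} (ht : StrictMono t) (y : ℕ → ℝ) (k : ℕ) (s : ℝ) :
    deriv (linInterp t y (k + 1)) s = (y (k + 1) - y k) / (t (k + 1) - t k) := by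
  have h1 : t (k + 1) - t k ≠ 0 := (sub_pos.2 (ht (by omega))).ne'
  have h1' : t k - t (k + 1) ≠ 0 := by rwa [← neg_ne_zero, neg_sub]
  have hq : linInterp t y (k + 1) = fun s => y k
      + (y (k + 1) - y k) / (t (k + 1) - t k) * (s - t k) := by
    funext s
    simp only [linInterp, Nat.add_sub_cancel]
    field_simp
    ring
  rw [hq]
  refine ((((hasDerivAt_id s).sub_const (t k)).const_mul
    ((y (k + 1) - y k) / (t (k + 1) - t k))).const_add (y k)).deriv.trans ?_
  rw [mul_one]

theorem integral_deriv_quadInterp_mul_soe {t : ℕ → ℝ} (ht : StrictMono t) {Nq : ℕ}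
    (θ ϖ : Fin Nq → ℝ) (y : ℕ → ℝ) (j : ℕ) (T : ℝ) :
    ∫ s in t j..t (j + 1), deriv (quadInterp t y (j + 1)) s * soe θ ϖ (T - s) =
      ∑ l, ϖ l * Real.exp (-(θ l) * T) *
        (expLeft (θ l) (t j) (t (j + 1)) (t (j + 2)) * (y (j + 1) - y j)
          + expRight (θ l) (t j) (t (j + 1)) (t (j + 2)) * (y (j + 2) - y (j + 1))) := by
  have h : ∀ s, deriv (quadInterp t y (j + 1)) s * soe θ ϖ (T - s) =
      ∑ l, ϖ l * Real.exp (-(θ l) * T) *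
        ((t (j + 2) + t (j + 1) - 2 * s) / ((t (j + 1) - t j) * (t (j + 2) - t j))
            * Real.exp (θ l * s) * (y (j + 1) - y j)
          + (2 * s - t j - t (j + 1)) / ((t (j + 2) - t (j + 1)) * (t (j + 2) - t j))
            * Real.exp (θ l * s) * (y (j + 2) - y (j + 1))) := by
    intro s
    rw [deriv_quadInterp ht, soe, Finset.mul_sum]
    refine Finset.sum_congr rfl fun l _ => ?_
    have : -(θ l) * (T - s) = -(θ l) * T + θ l * s := by ring
    rw [this, Real.exp_add]
    ring
  simp_rw [h]
  rw [intervalIntegral.integral_finsetSum fun l _ =>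
    Continuous.intervalIntegrable (by fun_prop) _ _]
  refine Finset.sum_congr rfl fun l _ => ?_
  rw [intervalIntegral.integral_const_mul,
    intervalIntegral.integral_add (Continuous.intervalIntegrable (by fun_prop) _ _)
      (Continuous.intervalIntegrable (by fun_prop) _ _),
    intervalIntegral.integral_mul_const, intervalIntegral.integral_mul_const,
    expLeft_eq_integral (ht (by omega)) (ht (by omega)), expRight_eq_integral]

theorem integral_singular_kernel {α p T : ℝ} (hα : α < 1) (hp : p ≤ T) :
    ∫ s in p..T, 1 / (T - s) ^ α = (T - p) ^ (1 - α) / (1 - α) := by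
  rw [intervalIntegral.integral_comp_sub_left (fun x => 1 / x ^ α), sub_self]
  have h : ∫ x in (0 : ℝ)..T - p, 1 / x ^ α = ∫ x in (0 : ℝ)..T - p, x ^ (-α) := by
    refine intervalIntegral.integral_congr fun x hx => ?_
    rw [Set.uIcc_of_le (sub_nonneg.2 hp)] at hx
    simp only [Real.rpow_neg hx.1, one_div]
  rw [h, integral_rpow (Or.inl (by linarith)), show -α + 1 = 1 - α by ring,
    Real.zero_rpow (by linarith), sub_zero]

theorem step_pos {t : ℕ → ℝ} (ht : StrictMono t) (m : ℕ) : 0 < step t (m + 1) :=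
  sub_pos.2 (ht (by simp))

/-- The quadratic interpolant on one interval also involves the increment over the next one.
Regrouping by increments gives each past increment a left and, after the first, a right
contribution. The current increment receives only the last right contribution, besides the singular
integral. -/
theorem fastOp_eq {α : ℝ} (hα1 : α < 1) {t : ℕ → ℝ} (ht : StrictMono t)
    {Nq : ℕ} (θ ϖ : Fin Nq → ℝ) (m : ℕ) (y : ℕ → ℝ) :
    fastOp α t θ ϖ (m + 1) y = 1 / Real.Gamma (1 - α) *
      (∑ l, ϖ l * Real.exp (-(θ l) * tStar α t (m + 1)) *
          (∑ j ∈ Finset.range m, histWeight (θ l) t (j + 1) * (y (j + 1) - y j)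
            + localWeight (θ l) t m * (y (m + 1) - y m))
        + (1 - α / 2) * ((1 - α / 2) * step t (m + 1)) ^ (-α) / (1 - α) * (y (m + 1) - y m)) := by
  have hτ := step_pos ht m
  have hσ : 0 < 1 - α / 2 := by linarith
  rw [fastOp]
  congr 2
  · rw [Finset.sum_Ico_eq_sum_range, Nat.add_sub_cancel]
    have h1 : ∀ i ∈ Finset.range m, (∫ s in t (1 + i - 1)..t (1 + i),
        deriv (quadInterp t y (1 + i)) s * soe θ ϖ (tStar α t (m + 1) - s)) =
        ∑ l, ϖ l * Real.exp (-(θ l) * tStar α t (m + 1)) *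
        (expLeft (θ l) (t i) (t (i + 1)) (t (i + 2)) * (y (i + 1) - y i)
          + expRight (θ l) (t i) (t (i + 1)) (t (i + 2)) * (y (i + 2) - y (i + 1))) := by
      intro i _
      rw [← integral_deriv_quadInterp_mul_soe ht, add_comm 1 i, Nat.add_sub_cancel]
    rw [Finset.sum_congr rfl h1, Finset.sum_comm]
    refine Finset.sum_congr rfl fun l _ => ?_
    rw [← Finset.mul_sum]
    congr 1
    clear h1 hτ
    induction m with
    | zero => simp [localWeight]
    | succ m ih =>
      rw [Finset.sum_range_succ, ih, Finset.sum_range_succ _ m]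
      simp only [histWeight, localWeight]
      ring
  · simp only [deriv_linInterp ht, Nat.add_sub_cancel]
    have hT : tStar α t (m + 1) = t m + (1 - α / 2) * step t (m + 1) := by
      simp [tStar]
    have hle : t m ≤ tStar α t (m + 1) := by
      rw [hT]
      exact le_add_of_nonneg_right (mul_pos hσ hτ).le
    have h := integral_singular_kernel hα1 hle
    have h2 : ∀ s, (y (m + 1) - y m) / (t (m + 1) - t m) / (tStar α t (m + 1) - s) ^ α =
        (y (m + 1) - y m) / (t (m + 1) - t m) * (1 / (tStar α t (m + 1) - s) ^ α) := by
      intro s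
      ring
    simp_rw [h2]
    rw [intervalIntegral.integral_const_mul, h, hT, add_sub_cancel_left,
      show 1 - α = 1 + -α by ring, Real.rpow_add (mul_pos hσ hτ), Real.rpow_one]
    have h3 : step t (m + 1) = t (m + 1) - t m := by simp [step]
    rw [← h3]
    have h4 : 1 + -α ≠ 0 := by linarith
    field_simp

/-! # Positivity of the bilinear form -/

/-- The inequality is homogeneous in the steps; in the ratio `ρ` it says `1 ≤ 3 ρ² (1 + ρ)`, whose
right side increases in `ρ` and equals one at `η`. -/
theorem cube_le_of_le_ratio {η p q r : ℝ} (hη : 0 < η) (hroot : 1 - 3 * η ^ 2 * (1 + η) = 0)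
    (hpq : p < q) (h : η ≤ (r - q) / (q - p)) :
    (q - p) ^ 3 ≤ 3 * (r - q) ^ 2 * (r - p) := by
  have hq : 0 < q - p := sub_pos.2 hpq
  have h1 : η * (q - p) ≤ r - q := (le_div_iff₀ hq).1 h
  have h0 : 0 < η * (q - p) := mul_pos hη hq
  have h2 : (η * (q - p)) ^ 2 ≤ (r - q) ^ 2 := pow_le_pow_left₀ h0.le h1 2
  have h3 : (q - p) * (1 + η) ≤ r - p := by linarith
  have h4 : (η * (q - p)) ^ 2 * ((q - p) * (1 + η)) ≤ (r - q) ^ 2 * (r - p) :=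
    mul_le_mul h2 h3 (by positivity) (sq_nonneg _)
  have h5 : (q - p) ^ 3 = 3 * ((η * (q - p)) ^ 2 * ((q - p) * (1 + η))) := by
    linear_combination (q - p) ^ 3 * hroot
  rw [h5]
  linarith

section Form

variable {α η ε Δt Tsoe L : ℝ} {Nq : ℕ} {θ ϖ : Fin Nq → ℝ} {t : ℕ → ℝ}

theorem localWeight_nonneg {ϑ : ℝ} (hϑ : 0 < ϑ) (ht : StrictMono t) (j : ℕ) :
    0 ≤ localWeight ϑ t j := by
  cases j with
  | zero => exact le_rfl
  | succ j => exact expRight_nonneg hϑ (ht (by omega)) (ht (by omega))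

theorem cube_step_le (hη : 0 < η) (hroot : 1 - 3 * η ^ 2 * (1 + η) = 0) (ht : StrictMono t)
    (hmesh : MeshCondition α η ε Δt Tsoe t) (j : ℕ) :
    (t (j + 1) - t j) ^ 3 ≤ 3 * (t (j + 2) - t (j + 1)) ^ 2 * (t (j + 2) - t j) := by
  refine cube_le_of_le_ratio hη hroot (ht (by omega)) ?_
  have := hmesh.ratio (j + 2) (by omega)
  simpa [step] using this

theorem histWeight_le {ϑ : ℝ} (hϑ : 0 < ϑ) (hη : 0 < η) (hroot : 1 - 3 * η ^ 2 * (1 + η) = 0)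
    (ht : StrictMono t) (hmesh : MeshCondition α η ε Δt Tsoe t) (j : ℕ) :
    histWeight ϑ t j ≤ Real.exp (ϑ * t j) := by
  match j with
  | 0 => exact (Real.exp_pos _).le
  | 1 =>
    simp only [histWeight, localWeight, add_zero]
    exact expLeft_le hϑ (ht (by omega)) (ht (by omega))
  | j + 2 =>
    exact expLeft_add_expRight_le hϑ (ht (by omega)) (ht (by omega)) (ht (by omega))
      (cube_step_le hη hroot ht hmesh j)

/-- The nodal value `exp (ϑ t_j)` separates consecutive weights: it bounds the `j`-th from above and
the left part of the next one from below. -/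
theorem monotone_histWeight {ϑ : ℝ} (hϑ : 0 < ϑ) (hη : 0 < η)
    (hroot : 1 - 3 * η ^ 2 * (1 + η) = 0)
    (ht : StrictMono t) (hmesh : MeshCondition α η ε Δt Tsoe t) :
    Monotone (histWeight ϑ t) := by
  refine monotone_nat_of_le_succ fun j => (histWeight_le hϑ hη hroot ht hmesh j).trans ?_
  have h1 : Real.exp (ϑ * t j) ≤ expLeft ϑ (t j) (t (j + 1)) (t (j + 2)) :=
    exp_le_expLeft hϑ (ht (by omega)) (ht (by omega))
  have h2 := localWeight_nonneg hϑ ht j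
  simp only [histWeight]
  linarith

theorem tStar_mono (hα0 : 0 < α) (hα1 : α < 1) (ht : StrictMono t) (m : ℕ) :
    tStar α t (m + 1) ≤ tStar α t (m + 2) := by
  have h1 := step_pos ht m
  have h2 := step_pos ht (m + 1)
  have h3 : step t (m + 1) = t (m + 1) - t m := by simp [step]
  simp only [tStar, Nat.add_sub_cancel, show m + 2 - 1 = m + 1 by omega]
  nlinarith

/-- The factor 2 is generous: it is the one carried by `localWeight` in the doubled diagonal of the
operator, so that these terms cancel in `sum_diagonal_le`. -/
theorem exp_mul_histWeight_succ_le {ϑ : ℝ} (hϑ : 0 < ϑ) (hα0 : 0 < α) (hα1 : α < 1)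
    (ht : StrictMono t) (m : ℕ) :
    Real.exp (-ϑ * tStar α t (m + 2)) * histWeight ϑ t (m + 1)
    ≤ Real.exp (-ϑ * ((1 - α / 2) * step t (m + 2)))
      + 2 * (Real.exp (-ϑ * tStar α t (m + 1)) * localWeight ϑ t m) := by
  have hx : Real.exp (-ϑ * tStar α t (m + 2)) ≤ Real.exp (-ϑ * tStar α t (m + 1)) :=
    Real.exp_le_exp.2 (mul_le_mul_of_nonpos_left (tStar_mono hα0 hα1 ht m) (by linarith))
  have hb := localWeight_nonneg hϑ ht m
  have h1 : Real.exp (-ϑ * tStar α t (m + 2)) * expLeft ϑ (t m) (t (m + 1)) (t (m + 2)) ≤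
      Real.exp (-ϑ * ((1 - α / 2) * step t (m + 2))) := by
    refine (mul_le_mul_of_nonneg_left (expLeft_le hϑ (ht (by omega)) (ht (by omega)))
      (Real.exp_pos _).le).trans_eq ?_
    rw [← Real.exp_add]
    simp only [tStar, show m + 2 - 1 = m + 1 by omega]
    ring_nf
  have h2 := mul_le_mul_of_nonneg_right hx hb
  have h3 := mul_nonneg (Real.exp_pos (-ϑ * tStar α t (m + 1))).le hb
  simp only [histWeight]
  linarith

/-- After `histWeight ϑ t m` is replaced by `exp (ϑ t_m)`, the exponents become the distances from
`t_m` to the next two off-set points. -/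
theorem exp_sub_exp_mul_histWeight_le {ϑ : ℝ} (hϑ : 0 < ϑ) (hα0 : 0 < α) (hα1 : α < 1)
    (hη : 0 < η) (hroot : 1 - 3 * η ^ 2 * (1 + η) = 0)
    (ht : StrictMono t) (hmesh : MeshCondition α η ε Δt Tsoe t) (m : ℕ) :
    (Real.exp (-ϑ * tStar α t (m + 1)) - Real.exp (-ϑ * tStar α t (m + 2))) * histWeight ϑ t m
    ≤ Real.exp (-ϑ * ((1 - α / 2) * step t (m + 1)))
      - Real.exp (-ϑ * ((1 - α / 2) * step t (m + 2) + step t (m + 1))) := by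
  have hx : Real.exp (-ϑ * tStar α t (m + 2)) ≤ Real.exp (-ϑ * tStar α t (m + 1)) :=
    Real.exp_le_exp.2 (mul_le_mul_of_nonpos_left (tStar_mono hα0 hα1 ht m) (by linarith))
  refine (mul_le_mul_of_nonneg_left (histWeight_le hϑ hη hroot ht hmesh m)
    (sub_nonneg.2 hx)).trans_eq ?_
  have h3 : step t (m + 1) = t (m + 1) - t m := by simp [step]
  rw [sub_mul, ← Real.exp_add, ← Real.exp_add]
  simp only [tStar, Nat.add_sub_cancel, show m + 2 - 1 = m + 1 by omega, h3]
  ring_nf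

theorem soe_eq_sum (s : ℝ) : soe θ ϖ s = ∑ l, ϖ l * Real.exp (-(θ l) * s) := rfl

theorem sum_exp_mul_histWeight_succ_le (hsoe : IsSOE α ε Δt Tsoe θ ϖ) (hα0 : 0 < α) (hα1 : α < 1)
    (ht : StrictMono t) (m : ℕ) :
    ∑ l, ϖ l * (Real.exp (-(θ l) * tStar α t (m + 2)) * histWeight (θ l) t (m + 1))
    ≤ soe θ ϖ ((1 - α / 2) * step t (m + 2))
      + 2 * ∑ l, ϖ l * (Real.exp (-(θ l) * tStar α t (m + 1)) * localWeight (θ l) t m) := by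
  rw [soe_eq_sum, Finset.mul_sum, ← Finset.sum_add_distrib]
  refine Finset.sum_le_sum fun l _ => ?_
  have := mul_le_mul_of_nonneg_left
    (exp_mul_histWeight_succ_le (hsoe.node_pos l) hα0 hα1 ht m) (hsoe.weight_pos l).le
  linarith

theorem sum_exp_sub_exp_mul_histWeight_le (hsoe : IsSOE α ε Δt Tsoe θ ϖ)
    (hα0 : 0 < α) (hα1 : α < 1) (hη : 0 < η) (hroot : 1 - 3 * η ^ 2 * (1 + η) = 0)
    (ht : StrictMono t) (hmesh : MeshCondition α η ε Δt Tsoe t) (m : ℕ) :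
    ∑ l, ϖ l * ((Real.exp (-(θ l) * tStar α t (m + 1)) - Real.exp (-(θ l) * tStar α t (m + 2)))
        * histWeight (θ l) t m)
    ≤ soe θ ϖ ((1 - α / 2) * step t (m + 1))
      - soe θ ϖ ((1 - α / 2) * step t (m + 2) + step t (m + 1)) := by
  rw [soe_eq_sum, soe_eq_sum, ← Finset.sum_sub_distrib]
  refine Finset.sum_le_sum fun l _ => ?_
  have := mul_le_mul_of_nonneg_left
    (exp_sub_exp_mul_histWeight_le (hsoe.node_pos l) hα0 hα1 hη hroot ht hmesh m)
    (hsoe.weight_pos l).le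
  linarith

/-! ### Power-kernel estimates from the step conditions, and diagonal dominance. -/

theorem antitoneOn_rpow_neg_sub (hα0 : 0 < α) :
    AntitoneOn (fun z : ℝ => z ^ (-α) - (z + 1) ^ (-α)) (Set.Ioi 0) := by
  have hd : ∀ z ∈ Set.Ioi (0 : ℝ), HasDerivAt (fun z : ℝ => z ^ (-α) - (z + 1) ^ (-α))
      (-α * z ^ (-α - 1) - -α * (z + 1) ^ (-α - 1)) z := by
    intro z hz
    have hz : 0 < z := hz
    have h1 := Real.hasDerivAt_rpow_const (x := z) (p := -α) (Or.inl hz.ne')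
    have h2 := ((hasDerivAt_id z).add_const 1).rpow_const (p := -α) (Or.inl (by simp; linarith))
    refine (h1.sub h2).congr_deriv ?_
    simp only [id]
    ring
  refine antitoneOn_of_deriv_nonpos (convex_Ioi 0)
    (fun z hz => (hd z hz).continuousAt.continuousWithinAt) ?_ ?_
  · rw [interior_Ioi]
    exact fun z hz => (hd z hz).differentiableAt.differentiableWithinAt
  · rw [interior_Ioi]
    intro z hz
    rw [(hd z hz).deriv]
    have hz : 0 < z := hz
    have h := Real.rpow_le_rpow_of_nonpos hz (by linarith : z ≤ z + 1) (by linarith : -α - 1 ≤ 0)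
    have := mul_le_mul_of_nonneg_left h hα0.le
    linarith

/-- Factoring out `step t (m + 1)` leaves `z ^ (-α) - (z + 1) ^ (-α)` at `z = σ ρ`, with `ρ` the
step ratio; it is antitone, so the worst case is `ρ = η`. -/
theorem rpow_neg_step_sub_le (hα0 : 0 < α) (hα1 : α < 1) (hη : 0 < η)
    (ht : StrictMono t) (hmesh : MeshCondition α η ε Δt Tsoe t) (m : ℕ) :
    ((1 - α / 2) * step t (m + 2)) ^ (-α) - ((1 - α / 2) * step t (m + 2) + step t (m + 1)) ^ (-α)
    ≤ step t (m + 1) ^ (-α) *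
      (((1 - α / 2) * η) ^ (-α) - ((1 - α / 2) * η + 1) ^ (-α)) := by
  have h1 := step_pos ht m
  have h2 := step_pos ht (m + 1)
  have hσ : 0 < 1 - α / 2 := by linarith
  have hr : η ≤ step t (m + 2) / step t (m + 1) := hmesh.ratio (m + 2) (by omega)
  have hρ : 0 < step t (m + 2) / step t (m + 1) := hη.trans_le hr
  have h3 := antitoneOn_rpow_neg_sub hα0 (Set.mem_Ioi.2 (mul_pos hσ hη))
    (Set.mem_Ioi.2 (mul_pos hσ hρ)) (mul_le_mul_of_nonneg_left hr hσ.le)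
  refine le_trans (le_of_eq ?_) (mul_le_mul_of_nonneg_left h3 (Real.rpow_nonneg h1.le _))
  rw [mul_sub, ← Real.mul_rpow h1.le (mul_pos hσ hρ).le, ← Real.mul_rpow h1.le (by positivity)]
  congr 2 <;> field_simp

theorem step_first_bound (hα0 : 0 < α) (hα1 : α < 1) (hε : 0 < ε) (hL : 0 < L)
    (ht : StrictMono t) (hstep : StepBound α η ε L t) :
    (3 - α) * L * Real.Gamma (1 - α) + ε + ((1 - α / 2) * step t 1) ^ (-α) * η ^ (-α)
      ≤ (2 - α) * ((1 - α / 2) * step t 1) ^ (-α) / (1 - α) := by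
  have hσ : 0 < 1 - α / 2 := by linarith
  have hτ := step_pos ht 0
  rw [zero_add] at hτ
  have hα : 0 < 1 - α := by linarith
  have hΓ := Real.Gamma_pos_of_pos hα
  have hP : 0 < ((1 - α / 2) * step t 1) ^ α := Real.rpow_pos_of_pos (mul_pos hσ hτ) _
  have h := hstep.first
  have hΓ2 : Real.Gamma (2 - α) = (1 - α) * Real.Gamma (1 - α) := by
    rw [← Real.Gamma_add_one hα.ne']
    ring_nf
  have h3α : 0 < 3 - α := by linarith
  rw [hΓ2, le_div_iff₀ (by positivity), ← mul_assoc, mul_comm (step t 1 ^ α),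
    ← Real.mul_rpow hσ.le hτ.le] at h
  rw [Real.rpow_neg (mul_pos hσ hτ).le]
  set P := ((1 - α / 2) * step t 1) ^ α
  have h2 := mul_le_mul_of_nonneg_left h (inv_pos.2 (mul_pos hP hα)).le
  refine le_of_sub_nonneg ((sub_nonneg.2 h2).trans_eq ?_)
  field_simp
  ring

theorem step_later_bound (hα0 : 0 < α) (hα1 : α < 1) (hε : 0 < ε) (hL : 0 < L)
    (ht : StrictMono t) (hstep : StepBound α η ε L t) (m : ℕ) :
    (3 - α) * L * Real.Gamma (1 - α) + 3 * ε + step t (m + 2) ^ (-α) *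
        (((1 - α / 2) * η) ^ (-α) - ((1 - α / 2) * η + 1) ^ (-α))
      ≤ ((1 - α / 2) * step t (m + 2)) ^ (-α) / (1 - α) := by
  have hσ : 0 < 1 - α / 2 := by linarith
  have hτ : 0 < step t (m + 2) := step_pos ht (m + 1)
  have hα : 0 < 1 - α := by linarith
  have hΓ := Real.Gamma_pos_of_pos hα
  have hP : 0 < step t (m + 2) ^ α := Real.rpow_pos_of_pos hτ _
  have hS : 0 < (1 - α / 2) ^ α := Real.rpow_pos_of_pos hσ _
  have h := hstep.later (m + 2) (by omega)
  have hΓ2 : Real.Gamma (2 - α) = (1 - α) * Real.Gamma (1 - α) := by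
    rw [← Real.Gamma_add_one hα.ne']
    ring_nf
  have h3α : 0 < 3 - α := by linarith
  rw [hΓ2, le_div_iff₀ (by positivity)] at h
  rw [Real.mul_rpow hσ.le hτ.le, Real.rpow_neg hσ.le, Real.rpow_neg hτ.le]
  set D := ((1 - α / 2) * η) ^ (-α) - ((1 - α / 2) * η + 1) ^ (-α)
  set S := (1 - α / 2) ^ α
  set P := step t (m + 2) ^ α
  have h2 := mul_le_mul_of_nonneg_left h (inv_pos.2 (mul_pos (mul_pos hS hP) hα)).le
  refine le_of_sub_nonneg ((sub_nonneg.2 h2).trans_eq ?_)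
  field_simp
  ring

/-- Diagonal dominance of the fast L2-1σ operator over the semiseparable matrices. -/
theorem sum_diagonal_le (hα0 : 0 < α) (hα1 : α < 1) (hε : 0 < ε) (hL : 0 < L)
    (hsoe : IsSOE α ε Δt Tsoe θ ϖ)
    (hη : 0 < η) (hroot : 1 - 3 * η ^ 2 * (1 + η) = 0)
    (ht : StrictMono t) (hmesh : MeshCondition α η ε Δt Tsoe t)
    (hstep : StepBound α η ε L t) (m : ℕ) :
    ∑ l, ϖ l * (Real.exp (-(θ l) * tStar α t (m + 2)) * histWeight (θ l) t (m + 1)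
        + (Real.exp (-(θ l) * tStar α t (m + 1)) - Real.exp (-(θ l) * tStar α t (m + 2)))
          * histWeight (θ l) t m)
      + (3 - α) * L * Real.Gamma (1 - α)
    ≤ 2 * (∑ l, ϖ l * (Real.exp (-(θ l) * tStar α t (m + 1)) * localWeight (θ l) t m)
      + (1 - α / 2) * ((1 - α / 2) * step t (m + 1)) ^ (-α) / (1 - α)) := by
  have hσ : 0 < 1 - α / 2 := by linarith
  have hα : 0 < 1 - α := by linarith
  have hcut : ∀ i, Δt ≤ (1 - α / 2) * step t (i + 2) := fun i => hmesh.cutoff (i + 2) (by omega)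
  have hhor : ∀ i, (1 - α / 2) * step t (i + 2) ≤ Tsoe := by
    intro i
    have h1 := hmesh.horizon (i + 2) (by omega)
    have h2 : 0 < step t (i + 2) := step_pos ht (i + 1)
    have h3 : 0 < step t (i + 2 + 1) := step_pos ht (i + 2)
    have h4 := mul_pos hσ h3
    have h5 : (1 - α / 2) * step t (i + 2) ≤ 1 * step t (i + 2) :=
      mul_le_mul_of_nonneg_right (by linarith) h2.le
    linarith
  have hA := sum_exp_mul_histWeight_succ_le hsoe hα0 hα1 ht m
  have hK := (abs_le.1 (hsoe.approx _ ⟨hcut m, hhor m⟩)).1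
  simp only [mul_add, Finset.sum_add_distrib] at hA ⊢
  -- For `m = 0` the weight `histWeight _ t 0` vanishes: one kernel value, hence one `ε`, remains,
  -- and the kernel is not needed at `σ τ_1`, where the cutoff is not assumed. Later steps use three
  -- values, hence `3 ε`.
  cases m with
  | zero =>
    have h0 := step_first_bound hα0 hα1 hε hL ht hstep
    simp only [histWeight, mul_zero, Finset.sum_const_zero, zero_add] at hA hK ⊢
    have hτ : 0 < step t 1 := step_pos ht 0
    have hr := hmesh.ratio 2 le_rfl
    rw [show 2 - 1 = 1 by rfl, le_div_iff₀ hτ] at hr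
    have h1 : ((1 - α / 2) * step t 2) ^ (-α) ≤
        ((1 - α / 2) * step t 1) ^ (-α) * η ^ (-α) := by
      rw [← Real.mul_rpow (mul_pos hσ hτ).le hη.le]
      refine Real.rpow_le_rpow_of_nonpos (by positivity) ?_ (by linarith)
      have := mul_le_mul_of_nonneg_left hr hσ.le
      linarith
    have h2 : 2 * ((1 - α / 2) * ((1 - α / 2) * step t 1) ^ (-α) / (1 - α)) =
        (2 - α) * ((1 - α / 2) * step t 1) ^ (-α) / (1 - α) := by ring
    linarith
  | succ m =>
    have h0 := step_later_bound hα0 hα1 hε hL ht hstep m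
    have hB := sum_exp_sub_exp_mul_histWeight_le hsoe hα0 hα1 hη hroot ht hmesh (m + 1)
    have hK2 := (abs_le.1 (hsoe.approx _ ⟨hcut m, hhor m⟩)).1
    have hmem : (1 - α / 2) * step t (m + 1 + 2) + step t (m + 1 + 1) ∈ Set.Icc Δt Tsoe := by
      refine ⟨(hcut (m + 1)).trans ?_, hmesh.horizon (m + 2) (by omega)⟩
      exact le_add_of_nonneg_right (step_pos ht (m + 1)).le
    have hK3 := (abs_le.1 (hsoe.approx _ hmem)).2
    have h1 := rpow_neg_step_sub_le hα0 hα1 hη ht hmesh (m + 1)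
    -- Since `2 σ = (1 - α) + 1`, the doubled local coefficient splits off one copy of the power
    -- kernel at `σ τ`, which cancels the one produced by `hB` and `hK2`. The rest is what
    -- `step_later_bound` controls.
    have h2 : 2 * ((1 - α / 2) * ((1 - α / 2) * step t (m + 1 + 1)) ^ (-α) / (1 - α)) =
        ((1 - α / 2) * step t (m + 1 + 1)) ^ (-α) / (1 - α)
          + ((1 - α / 2) * step t (m + 1 + 1)) ^ (-α) := by
      field_simp
      ring
    simp only [show m + 1 + 1 = m + 2 by rfl] at *
    linarith

/-- The bilinear form of the fast L2-1σ operator is bounded below. -/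
theorem sum_sq_le_sum_fastOp_mul (hα0 : 0 < α) (hα1 : α < 1) (hε : 0 < ε) (hL : 0 < L)
    (hsoe : IsSOE α ε Δt Tsoe θ ϖ)
    (hη : 0 < η) (hroot : 1 - 3 * η ^ 2 * (1 + η) = 0)
    (ht : StrictMono t) (hmesh : MeshCondition α η ε Δt Tsoe t)
    (hstep : StepBound α η ε L t) (y : ℕ → ℝ) (n : ℕ) :
    ∑ m ∈ Finset.range n, (3 - α) * L / 2 * (y (m + 1) - y m) ^ 2 ≤
      ∑ m ∈ Finset.range n, fastOp α t θ ϖ (m + 1) y * (y (m + 1) - y m) := by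
  have hα : 0 < 1 - α := by linarith
  have hΓ := Real.Gamma_pos_of_pos hα
  have hS : 0 ≤ ∑ l, ϖ l * ∑ m ∈ Finset.range n,
      (2 * Real.exp (-(θ l) * tStar α t (m + 1)) * (y (m + 1) - y m) *
          ∑ j ∈ Finset.range m, histWeight (θ l) t (j + 1) * (y (j + 1) - y j)
        + (Real.exp (-(θ l) * tStar α t (m + 2)) * histWeight (θ l) t (m + 1)
          + (Real.exp (-(θ l) * tStar α t (m + 1)) - Real.exp (-(θ l) * tStar α t (m + 2)))
          * histWeight (θ l) t m) * (y (m + 1) - y m) ^ 2) := by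
    refine Finset.sum_nonneg fun l _ => mul_nonneg (hsoe.weight_pos l).le ?_
    refine semiseparable_nonneg (fun m => Real.exp (-(θ l) * tStar α t (m + 1)))
      (histWeight (θ l) t) (fun j => y (j + 1) - y j) ?_ (fun k => (Real.exp_pos _).le)
      (monotone_histWeight (hsoe.node_pos l) hη hroot ht hmesh) rfl n
    refine antitone_nat_of_succ_le fun m => Real.exp_le_exp.2 ?_
    exact mul_le_mul_of_nonpos_left (tStar_mono hα0 hα1 ht m) (by linarith [hsoe.node_pos l])
  simp_rw [Finset.mul_sum (Finset.range n)] at hS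
  rw [Finset.sum_comm] at hS
  have hmain : ∀ m ∈ Finset.range n, ∑ l, ϖ l *
      (2 * Real.exp (-(θ l) * tStar α t (m + 1)) * (y (m + 1) - y m) *
          ∑ j ∈ Finset.range m, histWeight (θ l) t (j + 1) * (y (j + 1) - y j)
        + (Real.exp (-(θ l) * tStar α t (m + 2)) * histWeight (θ l) t (m + 1)
          + (Real.exp (-(θ l) * tStar α t (m + 1)) - Real.exp (-(θ l) * tStar α t (m + 2)))
          * histWeight (θ l) t m) * (y (m + 1) - y m) ^ 2) ≤
      2 * Real.Gamma (1 - α) * (fastOp α t θ ϖ (m + 1) y * (y (m + 1) - y m)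
        - (3 - α) * L / 2 * (y (m + 1) - y m) ^ 2) := by
    intro m _
    have hd := mul_le_mul_of_nonneg_right
      (sum_diagonal_le hα0 hα1 hε hL hsoe hη hroot ht hmesh hstep m)
      (sq_nonneg (y (m + 1) - y m))
    have e1 : ∑ l, ϖ l *
      (2 * Real.exp (-(θ l) * tStar α t (m + 1)) * (y (m + 1) - y m) *
          ∑ j ∈ Finset.range m, histWeight (θ l) t (j + 1) * (y (j + 1) - y j)
        + (Real.exp (-(θ l) * tStar α t (m + 2)) * histWeight (θ l) t (m + 1)
          + (Real.exp (-(θ l) * tStar α t (m + 1)) - Real.exp (-(θ l) * tStar α t (m + 2)))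
          * histWeight (θ l) t m) * (y (m + 1) - y m) ^ 2) =
      2 * (y (m + 1) - y m) * ∑ l, ϖ l * Real.exp (-(θ l) * tStar α t (m + 1)) *
          ∑ j ∈ Finset.range m, histWeight (θ l) t (j + 1) * (y (j + 1) - y j)
        + (∑ l, ϖ l * (Real.exp (-(θ l) * tStar α t (m + 2)) * histWeight (θ l) t (m + 1)
          + (Real.exp (-(θ l) * tStar α t (m + 1)) - Real.exp (-(θ l) * tStar α t (m + 2)))
          * histWeight (θ l) t m)) * (y (m + 1) - y m) ^ 2 := by
      rw [Finset.mul_sum Finset.univ, Finset.sum_mul, ← Finset.sum_add_distrib]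
      exact Finset.sum_congr rfl fun l _ => by ring
    have e2 : ∑ l, ϖ l * Real.exp (-(θ l) * tStar α t (m + 1)) *
          (∑ j ∈ Finset.range m, histWeight (θ l) t (j + 1) * (y (j + 1) - y j)
            + localWeight (θ l) t m * (y (m + 1) - y m)) =
        ∑ l, ϖ l * Real.exp (-(θ l) * tStar α t (m + 1)) *
          ∑ j ∈ Finset.range m, histWeight (θ l) t (j + 1) * (y (j + 1) - y j)
        + (∑ l, ϖ l * (Real.exp (-(θ l) * tStar α t (m + 1)) * localWeight (θ l) t m))
          * (y (m + 1) - y m) := by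
      rw [Finset.sum_mul, ← Finset.sum_add_distrib]
      exact Finset.sum_congr rfl fun l _ => by ring
    rw [e1, fastOp_eq hα1 ht, e2]
    have e3 : ∀ X : ℝ, 2 * Real.Gamma (1 - α) * (1 / Real.Gamma (1 - α) * X * (y (m + 1) - y m)
        - (3 - α) * L / 2 * (y (m + 1) - y m) ^ 2) =
        2 * X * (y (m + 1) - y m)
          - (3 - α) * L * Real.Gamma (1 - α) * (y (m + 1) - y m) ^ 2 := by
      intro X
      field_simp
    rw [e3]
    linarith
  -- The common positive factor `2 Γ(1 - α)` is divided out.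
  have h := hS.trans (Finset.sum_le_sum hmain)
  rw [← Finset.mul_sum, Finset.sum_sub_distrib] at h
  have h2 := nonneg_of_mul_nonneg_right h (by positivity)
  linarith

end Form

/-! # Lipschitz nonlinearities -/

theorem le_of_deriv_sign {h h' : ℝ → ℝ} {a : ℝ} (hh : ∀ y, HasDerivAt h (h' y) y)
    (hs : ∀ y, 0 ≤ h' y * (y - a)) (b : ℝ) : h a ≤ h b := by
  have hc : Continuous h := continuous_iff_continuousAt.2 fun y => (hh y).continuousAt
  rcases lt_trichotomy a b with hab | rfl | hab
  · obtain ⟨c, hc1, hc2⟩ := exists_hasDerivAt_eq_slope h h' hab hc.continuousOn fun y _ => hh y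
    have h1 : 0 ≤ h' c := nonneg_of_mul_nonneg_left (hs c) (sub_pos.2 hc1.1)
    rw [hc2] at h1
    rw [le_div_iff₀ (sub_pos.2 hab)] at h1
    linarith
  · exact le_rfl
  · obtain ⟨c, hc1, hc2⟩ := exists_hasDerivAt_eq_slope h h' hab hc.continuousOn fun y _ => hh y
    have h1 : h' c ≤ 0 := nonpos_of_mul_nonneg_left (hs c) (sub_neg.2 hc1.2)
    rw [hc2, div_nonpos_iff] at h1
    rcases h1 with h1 | h1 <;> linarith [h1.1, h1.2]

theorem abs_sub_le_of_abs_deriv_le {f : ℝ → ℝ} {L : ℝ} (hf : Differentiable ℝ f)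
    (hfL : ∀ y, |deriv f y| ≤ L) (a b : ℝ) : |f b - f a| ≤ L * |b - a| := by
  have := Convex.norm_image_sub_le_of_norm_deriv_le (f := f) (s := Set.univ) (C := L)
    (fun x _ => hf x) (fun x _ => hfL x) convex_univ (Set.mem_univ a) (Set.mem_univ b)
  simpa using this

/-- The quadratic majorant minus `F` has derivative `f a + L (y - a) - f y`, which has the sign of
`y - a` by the Lipschitz bound; the difference is therefore minimal at `a`. -/
theorem primitive_sub_le {f F : ℝ → ℝ} {L : ℝ} (hf : ∀ a b, |f b - f a| ≤ L * |b - a|)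
    (hF : ∀ y, HasDerivAt F (f y) y) (a b : ℝ) :
    F b - F a ≤ f a * (b - a) + L / 2 * (b - a) ^ 2 := by
  have hd : ∀ y, HasDerivAt (fun y => f a * (y - a) + L / 2 * (y - a) ^ 2 - F y)
      (f a + L * (y - a) - f y) y := by
    intro y
    have h0 := (hasDerivAt_id y).sub_const a
    refine (((h0.const_mul (f a)).add ((h0.pow 2).const_mul (L / 2))).sub (hF y)).congr_deriv ?_
    simp only [id, Nat.cast_ofNat]
    ring
  have h := le_of_deriv_sign (a := a) hd (fun y => ?_) b
  · simp only [sub_self] at h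
    linarith
  · have h1 := neg_abs_le ((f y - f a) * (y - a))
    have h2 := le_abs_self ((f y - f a) * (y - a))
    have h3 := mul_le_mul_of_nonneg_right (hf a y) (abs_nonneg (y - a))
    rw [abs_mul] at h1 h2
    have h4 : L * |y - a| * |y - a| = L * (y - a) ^ 2 := by
      rw [mul_assoc, abs_mul_abs_self, sq]
    nlinarith

/-! # The energy space is closed under differences -/

section Space

variable {d : ℕ} {Ω : Set (EuclideanSpace ℝ (Fin d))}
  {u v : EuclideanSpace ℝ (Fin d) → ℝ}
  {g h : EuclideanSpace ℝ (Fin d) → EuclideanSpace ℝ (Fin d)}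

theorem gradient_fun_sub {φ ψ : EuclideanSpace ℝ (Fin d) → ℝ} {x : EuclideanSpace ℝ (Fin d)}
    (hφ : DifferentiableAt ℝ φ x) (hψ : DifferentiableAt ℝ ψ x) :
    gradient (fun x => φ x - ψ x) x = gradient φ x - gradient ψ x := by
  simp only [gradient]
  rw [fderiv_fun_sub hφ hψ, map_sub]

theorem _root_.MeasureTheory.MemLp.integrable_smul_of_two {X E : Type*} [MeasurableSpace X]
    {μ : Measure X} [NormedAddCommGroup E] [NormedSpace ℝ E] {a : X → ℝ} {b : X → E}
    (ha : MemLp a 2 μ) (hb : MemLp b 2 μ) : Integrable (fun x => a x • b x) μ :=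
  memLp_one_iff_integrable.1 (hb.smul ha)

theorem MemH1.sub (hu : MemH1 Ω u g) (hv : MemH1 Ω v h) :
    MemH1 Ω (fun x => u x - v x) (fun x => g x - h x) where
  memLp := hu.memLp.sub hv.memLp
  memLp_grad := hu.memLp_grad.sub hv.memLp_grad
  integral_by_parts φ hφ hc hs := by
    have h1 : Continuous (gradient φ) :=
      (InnerProductSpace.toDual ℝ _).symm.continuous.comp (hφ.continuous_fderiv (by simp))
    have h2 : HasCompactSupport (gradient φ) :=
      (hc.fderiv (𝕜 := ℝ)).comp_left (g := (InnerProductSpace.toDual ℝ _).symm) (map_zero _)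
    have hφ2 : MemLp φ 2 (volume.restrict Ω) := (hφ.continuous.memLp_of_hasCompactSupport hc)
    have hg2 : MemLp (gradient φ) 2 (volume.restrict Ω) := h1.memLp_of_hasCompactSupport h2
    simp only [sub_smul, smul_sub]
    rw [integral_sub (hu.memLp.integrable_smul_of_two hg2) (hv.memLp.integrable_smul_of_two hg2),
      integral_sub (hφ2.integrable_smul_of_two hu.memLp_grad)
        (hφ2.integrable_smul_of_two hv.memLp_grad),
      hu.integral_by_parts φ hφ hc hs, hv.integral_by_parts φ hφ hc hs]
    abel

theorem tendsto_eLpNorm_sub {X E : Type*} [MeasurableSpace X] {μ : Measure X}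
    [NormedAddCommGroup E] {a b : X → E} {φ ψ : ℕ → X → E}
    (ha : AEStronglyMeasurable a μ) (hb : AEStronglyMeasurable b μ)
    (hφ : ∀ m, AEStronglyMeasurable (φ m) μ) (hψ : ∀ m, AEStronglyMeasurable (ψ m) μ)
    (h1 : Tendsto (fun m => eLpNorm (fun x => a x - φ m x) 2 μ) atTop (𝓝 0))
    (h2 : Tendsto (fun m => eLpNorm (fun x => b x - ψ m x) 2 μ) atTop (𝓝 0)) :
    Tendsto (fun m => eLpNorm (fun x => (a x - b x) - (φ m x - ψ m x)) 2 μ) atTop (𝓝 0) := by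
  have h3 := h1.add h2
  rw [add_zero] at h3
  refine tendsto_of_tendsto_of_tendsto_of_le_of_le tendsto_const_nhds h3 (fun _ => zero_le)
    fun m => ?_
  have h4 := eLpNorm_sub_le (ha.sub (hφ m)) (hb.sub (hψ m)) (p := 2) (by norm_num)
  refine le_trans (le_of_eq ?_) h4
  congr 1
  funext x
  simp only [Pi.sub_apply]
  abel

theorem IsH1Limit.sub {C : (EuclideanSpace ℝ (Fin d) → ℝ) → Prop}
    (hC : ∀ φ ψ, C φ → C ψ → C (fun x => φ x - ψ x)) (hC' : ∀ φ, C φ → ContDiff ℝ ∞ φ)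
    (hu : MemH1 Ω u g) (hv : MemH1 Ω v h) (hu' : IsH1Limit Ω C u g) (hv' : IsH1Limit Ω C v h) :
    IsH1Limit Ω C (fun x => u x - v x) (fun x => g x - h x) := by
  obtain ⟨φ, hφ, h1, h2⟩ := hu'
  obtain ⟨ψ, hψ, h3, h4⟩ := hv'
  have hgc : ∀ φ, C φ → Continuous (gradient φ) := fun φ hφ =>
    (InnerProductSpace.toDual ℝ _).symm.continuous.comp ((hC' φ hφ).continuous_fderiv (by simp))
  refine ⟨fun m x => φ m x - ψ m x, fun m => hC _ _ (hφ m) (hψ m), ?_, ?_⟩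
  · exact tendsto_eLpNorm_sub hu.memLp.1 hv.memLp.1
      (fun m => (hC' _ (hφ m)).continuous.aestronglyMeasurable)
      (fun m => (hC' _ (hψ m)).continuous.aestronglyMeasurable) h1 h3
  · have h5 : ∀ m x, gradient (fun x => φ m x - ψ m x) x =
        gradient (φ m) x - gradient (ψ m) x := fun m x =>
      gradient_fun_sub ((hC' _ (hφ m)).differentiable (by simp) x)
        ((hC' _ (hψ m)).differentiable (by simp) x)
    simp_rw [h5]
    exact tendsto_eLpNorm_sub hu.memLp_grad.1 hv.memLp_grad.1
      (fun m => (hgc _ (hφ m)).aestronglyMeasurable)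
      (fun m => (hgc _ (hψ m)).aestronglyMeasurable) h2 h4

theorem BoundaryCondition.MemSpace.memH1 {bc : BoundaryCondition d} (hu : bc.MemSpace Ω u g) :
    MemH1 Ω u g := by
  cases bc with
  | dirichlet => exact hu.1
  | neumann => exact hu
  | periodic c b => exact hu.1

/-- This makes `u^k - u^{k-1}` an admissible test function. -/
theorem BoundaryCondition.MemSpace.sub {bc : BoundaryCondition d} (hu : bc.MemSpace Ω u g)
    (hv : bc.MemSpace Ω v h) : bc.MemSpace Ω (fun x => u x - v x) (fun x => g x - h x) := by
  cases bc with
  | dirichlet =>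
    refine ⟨hu.1.sub hv.1, hu.2.sub ?_ (fun φ hφ => hφ.1) hu.1 hv.1 hv.2⟩
    rintro φ ψ ⟨h1, h2, h3⟩ ⟨h4, h5, h6⟩
    exact ⟨h1.sub h4, h2.sub h5, (tsupport_sub φ ψ).trans (Set.union_subset h3 h6)⟩
  | neumann => exact MemH1.sub hu hv
  | periodic c b =>
    refine ⟨hu.1.sub hv.1, hu.2.sub ?_ (fun φ hφ => hφ.1) hu.1 hv.1 hv.2⟩
    rintro φ ψ ⟨h1, h2⟩ ⟨h3, h4⟩
    exact ⟨h1.sub h3, fun i x => by simp only [h2, h4]⟩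

end Space

/-! # Integrability -/

section Integrability

variable {X : Type*} [MeasurableSpace X] {μ : Measure X}

theorem memLp_lipschitz_comp [IsFiniteMeasure μ] {f : ℝ → ℝ} {L : ℝ} {u : X → ℝ}
    (hf : Continuous f) (hfL : ∀ a b, |f b - f a| ≤ L * |b - a|) (hu : MemLp u 2 μ) :
    MemLp (fun x => f (u x)) 2 μ := by
  refine ((memLp_const |f 0|).add (hu.norm.const_mul L)).mono'
    (hf.comp_aestronglyMeasurable hu.1) (Eventually.of_forall fun x => ?_)
  have h1 := hfL 0 (u x)
  rw [sub_zero] at h1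
  have h2 := abs_sub_abs_le_abs_sub (f (u x)) (f 0)
  simp only [Pi.add_apply, Real.norm_eq_abs]
  linarith

/-- `F` grows at most quadratically: `primitive_sub_le` about `0`, applied to `F` and to `-F`,
bounds it from both sides. -/
theorem integrable_primitive_comp [IsFiniteMeasure μ] {f F : ℝ → ℝ} {L : ℝ} {u : X → ℝ}
    (hfL : ∀ a b, |f b - f a| ≤ L * |b - a|) (hF : ∀ y, HasDerivAt F (f y) y)
    (hu : MemLp u 2 μ) : Integrable (fun x => F (u x)) μ := by
  have hc : Continuous F := continuous_iff_continuousAt.2 fun y => (hF y).continuousAt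
  have hi : Integrable (fun x => |F 0| + |f 0| * |u x| + L / 2 * u x ^ 2) μ :=
    ((integrable_const _).add (((hu.integrable (by norm_num)).norm).const_mul _)).add
      (hu.integrable_sq.const_mul _)
  refine hi.mono' (hc.comp_aestronglyMeasurable hu.1) (Eventually.of_forall fun x => ?_)
  have h1 := primitive_sub_le hfL hF 0 (u x)
  have h2 := primitive_sub_le (f := fun y => -f y) (F := fun y => -F y) (L := L)
    (fun a b => by rw [← neg_sub', abs_neg]; exact hfL a b) (fun y => (hF y).neg) 0 (u x)
  have h3 := le_abs_self (F 0)
  have h4 := neg_abs_le (F 0)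
  have h5 := le_abs_self (f 0 * u x)
  have h6 := neg_abs_le (f 0 * u x)
  rw [abs_mul] at h5 h6
  rw [sub_zero] at h1 h2
  rw [Real.norm_eq_abs, abs_le]
  constructor <;> linarith

theorem integrable_inner_of_memLp_two {E : Type*} [NormedAddCommGroup E] [InnerProductSpace ℝ E]
    {a b : X → E} (ha : MemLp a 2 μ) (hb : MemLp b 2 μ) :
    Integrable (fun x => (inner ℝ (a x) (b x) : ℝ)) μ :=
  (ha.norm.integrable_mul hb.norm).mono' (ha.1.inner hb.1)
    (Eventually.of_forall fun x => norm_inner_le_norm (a x) (b x))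

theorem memLp_fastOp {α : ℝ} (hα1 : α < 1) {t : ℕ → ℝ} (ht : StrictMono t)
    {Nq : ℕ} (θ ϖ : Fin Nq → ℝ) (m : ℕ) {u : ℕ → X → ℝ} (hu : ∀ n, MemLp (u n) 2 μ) :
    MemLp (fun x => fastOp α t θ ϖ (m + 1) fun j => u j x) 2 μ := by
  simp only [fastOp_eq hα1 ht]
  have hδ : ∀ j, MemLp (fun x => u (j + 1) x - u j x) 2 μ := fun j => (hu (j + 1)).sub (hu j)
  have h1 : ∀ l, MemLp (fun x => ϖ l * Real.exp (-(θ l) * tStar α t (m + 1)) *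
      (∑ j ∈ Finset.range m, histWeight (θ l) t (j + 1) * (u (j + 1) x - u j x)
        + localWeight (θ l) t m * (u (m + 1) x - u m x))) 2 μ := by
    intro l
    have h2 : MemLp (fun x => ∑ j ∈ Finset.range m,
        histWeight (θ l) t (j + 1) * (u (j + 1) x - u j x)) 2 μ :=
      memLp_finsetSum _ fun j _ => (hδ j).const_mul _
    exact (h2.add ((hδ m).const_mul _)).const_mul _
  have h3 := memLp_finsetSum Finset.univ fun l _ => h1 l
  have h4 := (hδ m).const_mul
    ((1 - α / 2) * ((1 - α / 2) * step t (m + 1)) ^ (-α) / (1 - α))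
  exact (h3.add h4).const_mul _

end Integrability

/-! # Energy stability -/

theorem energy_increment_identity {E : Type*} [NormedAddCommGroup E] [InnerProductSpace ℝ E]
    (α : ℝ) (a b : E) :
    (inner ℝ ((1 - α / 2) • a + (α / 2) • b) (a - b) : ℝ) =
      ‖a‖ ^ 2 / 2 - ‖b‖ ^ 2 / 2 + (1 - α) / 2 * ‖a - b‖ ^ 2 := by
  rw [@norm_sub_sq_real, inner_add_left, inner_sub_right, inner_sub_right, inner_smul_left,
    inner_smul_left, inner_smul_left, inner_smul_left, real_inner_self_eq_norm_sq,
    real_inner_self_eq_norm_sq, real_inner_comm a b]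
  simp only [conj_trivial]
  ring

section Energy

variable {d : ℕ} {Ω : Set (EuclideanSpace ℝ (Fin d))}

/-- The constant is `L / 2` from the quadratic bound on `F`, plus `(1 - α / 2) L` from `deriv f ≥
-L` in the Newton term. The gradient surplus `(1 - α) / 2 * ‖g x - h x‖ ^ 2` is discarded. -/
theorem energyDensity_sub_le {α ν L : ℝ} (hα0 : 0 < α) (hα1 : α < 1) {f F : ℝ → ℝ}
    (hf : Differentiable ℝ f) (hfL : ∀ y, |deriv f y| ≤ L) (hF : ∀ y, HasDerivAt F (f y) y)
    (u v : EuclideanSpace ℝ (Fin d) → ℝ)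
    (g h : EuclideanSpace ℝ (Fin d) → EuclideanSpace ℝ (Fin d)) (x : EuclideanSpace ℝ (Fin d)) :
    energyDensity ν F u g x - energyDensity ν F v h x ≤
      ν ^ 2 * inner ℝ ((1 - α / 2) • g x + (α / 2) • h x) (g x - h x)
        + (f (v x) + (1 - α / 2) * deriv f (v x) * (u x - v x)) * (u x - v x)
        + (3 - α) * L / 2 * (u x - v x) ^ 2 := by
  have h1 := primitive_sub_le (abs_sub_le_of_abs_deriv_le hf hfL) hF (v x) (u x)
  have h2 := (abs_le.1 (hfL (v x))).1
  have h3 : 0 ≤ (1 - α / 2) * ((deriv f (v x) + L) * (u x - v x) ^ 2) :=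
    mul_nonneg (by linarith) (mul_nonneg (by linarith) (sq_nonneg _))
  have h4 : 0 ≤ ν ^ 2 * ((1 - α) / 2 * ‖g x - h x‖ ^ 2) :=
    mul_nonneg (sq_nonneg _) (mul_nonneg (by linarith) (sq_nonneg _))
  rw [energy_increment_identity, energyDensity, energyDensity]
  linarith

theorem integrableOn_energyDensity (hΩ : Bornology.IsBounded Ω) {ν L : ℝ} {f F : ℝ → ℝ}
    (hfL : ∀ a b, |f b - f a| ≤ L * |b - a|) (hF : ∀ y, HasDerivAt F (f y) y)
    {u : EuclideanSpace ℝ (Fin d) → ℝ}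
    {g : EuclideanSpace ℝ (Fin d) → EuclideanSpace ℝ (Fin d)} (hu : MemH1 Ω u g) :
    IntegrableOn (energyDensity ν F u g) Ω := by
  have : IsFiniteMeasure (volume.restrict Ω) := ⟨by simpa using hΩ.measure_lt_top⟩
  exact ((hu.memLp_grad.norm.integrable_sq).const_mul _).add
    (integrable_primitive_comp hfL hF hu.memLp)

theorem energy_increment_le (hΩ : Bornology.IsBounded Ω) {bc : BoundaryCondition d}
    {α ν L : ℝ} (hα0 : 0 < α) (hα1 : α < 1) {f F : ℝ → ℝ}
    (hf : Differentiable ℝ f) (hfL : ∀ y, |deriv f y| ≤ L) (hF : ∀ y, HasDerivAt F (f y) y)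
    {t : ℕ → ℝ} {Nq : ℕ} {θ ϖ : Fin Nq → ℝ} {u : ℕ → EuclideanSpace ℝ (Fin d) → ℝ}
    {G : ℕ → EuclideanSpace ℝ (Fin d) → EuclideanSpace ℝ (Fin d)}
    (hu : IsNumericalSolution bc Ω α ν f t θ ϖ u G) (m : ℕ) :
    (∫ x in Ω, energyDensity ν F (u (m + 1)) (G (m + 1)) x)
        - ∫ x in Ω, energyDensity ν F (u m) (G m) x ≤
      (∫ x in Ω, (3 - α) * L / 2 * (u (m + 1) x - u m x) ^ 2)
        - ∫ x in Ω, fastOp α t θ ϖ (m + 1) (fun j => u j x) * (u (m + 1) x - u m x) := by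
  have : IsFiniteMeasure (volume.restrict Ω) := ⟨by simpa using hΩ.measure_lt_top⟩
  have hH : ∀ n, MemH1 Ω (u n) (G n) := fun n => (hu.mem n).memH1
  have hLip := abs_sub_le_of_abs_deriv_le hf hfL
  have hE : ∀ n, Integrable (energyDensity ν F (u n) (G n)) (volume.restrict Ω) := fun n =>
    integrableOn_energyDensity hΩ hLip hF (hH n)
  have hs := hu.scheme (m + 1) (by omega) _ _ ((hu.mem (m + 1)).sub (hu.mem m))
  rw [Nat.add_sub_cancel] at hs
  have hδ : MemLp (fun x => u (m + 1) x - u m x) 2 (volume.restrict Ω) :=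
    (hH (m + 1)).memLp.sub (hH m).memLp
  have hV : MemLp (fun x => (1 - α / 2) • G (m + 1) x + (α / 2) • G m x) 2
      (volume.restrict Ω) :=
    ((hH (m + 1)).memLp_grad.const_smul (1 - α / 2)).add ((hH m).memLp_grad.const_smul (α / 2))
  have hW : MemLp (fun x => G (m + 1) x - G m x) 2 (volume.restrict Ω) :=
    (hH (m + 1)).memLp_grad.sub (hH m).memLp_grad
  have hI : Integrable (fun x => (inner ℝ ((1 - α / 2) • G (m + 1) x + (α / 2) • G m x)
      (G (m + 1) x - G m x) : ℝ)) (volume.restrict Ω) :=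
    integrable_inner_of_memLp_two hV hW
  have hN : MemLp (fun x => f (u m x)
      + (1 - α / 2) * deriv f (u m x) * (u (m + 1) x - u m x)) 2 (volume.restrict Ω) := by
    refine (memLp_lipschitz_comp hf.continuous hLip (hH m).memLp).add ?_
    refine (hδ.const_mul ((1 - α / 2) * L)).mono ?_ (Eventually.of_forall fun x => ?_)
    -- The derivative of `f` need not be continuous, but it is Borel measurable and bounded.
    · exact ((((measurable_deriv f).comp_aemeasurable
        (hH m).memLp.1.aemeasurable).const_mul _).aestronglyMeasurable).mul hδ.1
    · rw [norm_mul, norm_mul, norm_mul, norm_mul]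
      have h1 : ‖deriv f (u m x)‖ ≤ ‖L‖ := (hfL _).trans (le_abs_self L)
      gcongr
  have hNδ : Integrable (fun x => (f (u m x)
      + (1 - α / 2) * deriv f (u m x) * (u (m + 1) x - u m x)) * (u (m + 1) x - u m x))
      (volume.restrict Ω) := hN.integrable_mul hδ
  have hD : Integrable (fun x => (3 - α) * L / 2 * (u (m + 1) x - u m x) ^ 2)
      (volume.restrict Ω) := hδ.integrable_sq.const_mul _
  have hI2 : Integrable (fun x => ν ^ 2 * inner ℝ ((1 - α / 2) • G (m + 1) x + (α / 2) • G m x)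
        (G (m + 1) x - G m x)
      + (f (u m x) + (1 - α / 2) * deriv f (u m x) * (u (m + 1) x - u m x))
        * (u (m + 1) x - u m x)) (volume.restrict Ω) := (hI.const_mul (ν ^ 2)).add hNδ
  have h : ∫ x in Ω, (energyDensity ν F (u (m + 1)) (G (m + 1)) x - energyDensity ν F (u m) (G m) x)
      ≤ ∫ x in Ω, (ν ^ 2 * inner ℝ ((1 - α / 2) • G (m + 1) x + (α / 2) • G m x)
          (G (m + 1) x - G m x)
        + (f (u m x) + (1 - α / 2) * deriv f (u m x) * (u (m + 1) x - u m x))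
          * (u (m + 1) x - u m x)
        + (3 - α) * L / 2 * (u (m + 1) x - u m x) ^ 2) :=
    integral_mono ((hE (m + 1)).sub (hE m)) (hI2.add hD) fun x =>
      energyDensity_sub_le hα0 hα1 hf hfL hF (u (m + 1)) (u m) (G (m + 1)) (G m) x
  rw [integral_sub (hE (m + 1)) (hE m), integral_add hI2 hD,
    integral_add (hI.const_mul (ν ^ 2)) hNδ, integral_const_mul] at h
  linarith

end Energy

end FastL21

theorem theorem4p2 {d : ℕ}
    (Ω : Set (EuclideanSpace ℝ (Fin d))) (hΩ_open : IsOpen Ω) (hΩ_bdd : Bornology.IsBounded Ω)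
    (bc : FastL21.BoundaryCondition d) (hbc : bc.Compatible Ω)
    (α ν L : ℝ) (hα0 : 0 < α) (hα1 : α < 1) (hν : 0 < ν) (hL : 0 < L)
    (f F : ℝ → ℝ) (hf : Differentiable ℝ f) (hfL : ∀ y, |deriv f y| ≤ L)
    (hF : ∀ y, HasDerivAt F (f y) y)
    (ε Δt Tsoe : ℝ) (hε : 0 < ε) (hΔt : 0 < Δt) (hTsoe : Δt < Tsoe)
    (Nq : ℕ) (θ ϖ : Fin Nq → ℝ) (hsoe : FastL21.IsSOE α ε Δt Tsoe θ ϖ)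
    (η : ℝ) (hη_pos : 0 < η) (hη_root : 1 - 3 * η ^ 2 * (1 + η) = 0)
    (t : ℕ → ℝ) (ht : FastL21.IsTimeMesh t)
    (hmesh : FastL21.MeshCondition α η ε Δt Tsoe t)
    (hstep : FastL21.StepBound α η ε L t)
    (u : ℕ → EuclideanSpace ℝ (Fin d) → ℝ)
    (G : ℕ → EuclideanSpace ℝ (Fin d) → EuclideanSpace ℝ (Fin d))
    (hu : FastL21.IsNumericalSolution bc Ω α ν f t θ ϖ u G) :
    (∀ n, MeasureTheory.IntegrableOn (FastL21.energyDensity ν F (u n) (G n)) Ω) ∧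
      ∀ n, 1 ≤ n →
        ∫ x in Ω, FastL21.energyDensity ν F (u n) (G n) x ≤
          ∫ x in Ω, FastL21.energyDensity ν F (u 0) (G 0) x := by
  refine ⟨fun n => FastL21.integrableOn_energyDensity hΩ_bdd
    (FastL21.abs_sub_le_of_abs_deriv_le hf hfL) hF (hu.mem n).memH1, fun n _ => ?_⟩
  have hH : ∀ n, MemLp (u n) 2 (volume.restrict Ω) := fun n => (hu.mem n).memH1.memLp
  have hδ : ∀ m, MemLp (fun x => u (m + 1) x - u m x) 2 (volume.restrict Ω) := fun m =>
    (hH (m + 1)).sub (hH m)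
  have hD : ∀ m, Integrable (fun x => (3 - α) * L / 2 * (u (m + 1) x - u m x) ^ 2)
      (volume.restrict Ω) := fun m => (hδ m).integrable_sq.const_mul _
  have hA : ∀ m, Integrable (fun x => FastL21.fastOp α t θ ϖ (m + 1) (fun j => u j x) *
      (u (m + 1) x - u m x)) (volume.restrict Ω) := fun m =>
    (FastL21.memLp_fastOp hα1 ht.strictMono θ ϖ m hH).integrable_mul (hδ m)
  have h1 := Finset.sum_le_sum fun m (_ : m ∈ Finset.range n) =>
    FastL21.energy_increment_le hΩ_bdd hα0 hα1 hf hfL hF hu m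
  rw [Finset.sum_range_sub (fun m => ∫ x in Ω, FastL21.energyDensity ν F (u m) (G m) x),
    Finset.sum_sub_distrib, ← integral_finsetSum _ fun m _ => hD m,
    ← integral_finsetSum _ fun m _ => hA m] at h1
  -- The operator acts in time only, so the lower bound on its quadratic form holds at each `x`, for
  -- the sequence `j ↦ u j x`, and is then integrated over `Ω`.
  have h2 := integral_mono (integrable_finsetSum (Finset.range n) fun m _ => hD m)
    (integrable_finsetSum (Finset.range n) fun m _ => hA m) fun x =>
    FastL21.sum_sq_le_sum_fastOp_mul hα0 hα1 hε hL hsoe hη_pos hη_root ht.strictMono hmesh hstep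
      (fun j => u j x) n
  linarith
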